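/- **Setting.** Let $\overline M=M\cup\partial M$ be a (Hausdorff, second countable) $C^\infty$ manifold with boundary of dimension $n\ge 1$, with interior $M$ and *compact* boundary $\partial M$ ($\overline M$ need not be compact), and let $\varphi:T\overline M\to[0,\infty)$ be a $C^\infty$ Finsler metric: $\varphi$ is continuous, smooth and positive off the zero section, positively homogeneous of degree one on each fibre (not necessarily symmetric), and the fibrewise Hessian of $\varphi^2$ is positive definite off the zero section. Let $r$ be the geodesic vector field on $T\overline M$, whose integral curves are the velocity curves of geodesics, i.e. of solutions of the Euler–Lagrange equation of $\tfrac12\varphi^2$. Let $\Gamma:\partial M\to T\overline M$ be a smooth section over $\partial M$ of the projection $\pi:T\overline M\to\overline M$ such that $\Gamma(x)$ points to the inside of $M$ for every $x\in\partial M$. The *dual form* $\hat X$ of $X\in T_pM$ is the one form with $\hat X(X)=\varphi(X)^2$ that vanishes on the hyperplane tangent at $X$ to $\{W\in T_pM:\varphi(W)=\varphi(X)\}$. For $q\neq p$ in a convex neighbourhood of $p$, $v_p(q)\in T_pM$ is the initial velocity of the unique unit speed minimizing geodesic from $p$ to $q$. For $S\subset M$ let $A(S)\subset T\overline M$ be the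 union of all integral segments of $r$ with initial point in $\Gamma(\partial M)$ whose projections do not meet $S$. The set $S$ *splits* $M$ if $\pi$ restricts to a bijection from the set of elements of $A(S)$ lying over $M$ onto $M\setminus S$. In that case, for $q\in M\setminus S$ let $R_q=\{X\}$, where $X$ is the unique vector of $A(S)\cap T_qM$, and for $p\in S$ let $R_p\subset T_pM$ be the set of all limits in $TM$, lying in $T_pM$, of sequences $X_i\in R_{q_i}$ with $q_i\in M\setminus S$. Put $R_p^*=\{\hat X: X\in R_p\}\subset T_p^*M$. A set $S\subset M$ that splits $M$ is a *split locus* if $S$ is the closure in $M$ of $\{p\in S:\ R_p\text{ has at least two elements}\}$. It is *balanced* if for every $p\in S$ and all sequences $p_i\to p$ and $X_i\in R_{p_i}$ such that $v_{p_i}(p)\to v\in T_pM$ and $X_i\to X_\infty\in R_p$, one has $$\hat X_\infty(v)=\max\{w(v):\ w\in R_p^*\}.$$ **Proposition.** Let $S$ be a balanced split locus in this setting and let $0\le k\le n$. Then the set of points $p\in S$ such that the convex hull $\mathrm{co}(R_p^*)\subset T_p^*M$ has (affine) dimension exactly $k$ is (countably) $(n-k)$-rectifiable: in every chart it is covered by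 countably many images of Lipschitz maps $\mathbb R^{n-k}\to\mathbb R^n$. -/

import Mathlib

open Set Filter Topology Manifold
open scoped ContDiff

noncomputable section

namespace SplitLocus

/-- The tangent bundle of a smooth manifold with boundary of dimension `n`. -/
abbrev TM (n : ℕ) [NeZero n] (M : Type*) [TopologicalSpace M]
    [ChartedSpace (EuclideanHalfSpace n) M] [IsManifold (𝓡∂ n) ∞ M] : Type _ :=
  TangentBundle (𝓡∂ n) M

/-- A (not necessarily reversible) `C^∞` Finsler metric: a function on the tangent bundle, smooth
off the zero section, positive off the zero section, positively homogeneous of degree one on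
every fibre, and such that the fibrewise Hessian of its square is positive definite. -/
structure FinslerMetric (n : ℕ) [NeZero n] (M : Type*) [TopologicalSpace M]
    [ChartedSpace (EuclideanHalfSpace n) M] [IsManifold (𝓡∂ n) ∞ M] where
  toFun : TM n M → ℝ
  continuous_toFun : Continuous toFun
  smooth' : ContMDiffOn (𝓡∂ n).tangent 𝓘(ℝ, ℝ) ∞ toFun {z | z.2 ≠ 0}
  pos' : ∀ (p : M) (v : TangentSpace (𝓡∂ n) p), v ≠ 0 → 0 < toFun ⟨p, v⟩
  homog' : ∀ (p : M) (v : TangentSpace (𝓡∂ n) p) (c : ℝ), 0 < c →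
    toFun ⟨p, c • v⟩ = c * toFun ⟨p, v⟩
  convex' : ∀ (p : M) (v w : TangentSpace (𝓡∂ n) p), v ≠ 0 → w ≠ 0 →
    0 < iteratedDeriv 2 (fun t : ℝ => toFun ⟨p, v + t • w⟩ ^ 2) 0

variable {n : ℕ} [NeZero n] {M : Type*} [TopologicalSpace M]
  [ChartedSpace (EuclideanHalfSpace n) M] [IsManifold (𝓡∂ n) ∞ M]

/-! ### Geodesics -/

/-- The coordinates `(x, v)` on the tangent bundle induced by the chart at `p₀`. -/
def bundleChart (p₀ : M) :
    PartialEquiv (TM n M) (EuclideanSpace ℝ (Fin n) × EuclideanSpace ℝ (Fin n)) :=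
  extChartAt (𝓡∂ n).tangent (⟨p₀, 0⟩ : TM n M)

/-- The Lagrangian `L(x, v) = φ(x, v)² / 2` in the coordinates induced by the chart at `p₀`. -/
def lagrangian (φ : FinslerMetric n M) (p₀ : M) (x v : EuclideanSpace ℝ (Fin n)) : ℝ :=
  φ.toFun ((bundleChart p₀).symm (x, v)) ^ 2 / 2

/-- The partial derivative `∂L/∂v` at the tangent vector `z`, in the chart at `p₀`. -/
def dLdv (φ : FinslerMetric n M) (p₀ : M) (z : TM n M) : EuclideanSpace ℝ (Fin n) →L[ℝ] ℝ :=
  fderiv ℝ (fun v => lagrangian φ p₀ (bundleChart p₀ z).1 v) (bundleChart p₀ z).2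

/-- The partial derivative `∂L/∂x` at the tangent vector `z`, in the chart at `p₀`
(one-sided at boundary points, where the chart takes values in the boundary of a half-space). -/
def dLdx (φ : FinslerMetric n M) (p₀ : M) (z : TM n M) : EuclideanSpace ℝ (Fin n) →L[ℝ] ℝ :=
  fderivWithin ℝ (fun x => lagrangian φ p₀ x (bundleChart p₀ z).2) (range (𝓡∂ n))
    (bundleChart p₀ z).1

/-- `η : s → TM` is an integral curve of the geodesic vector field: `η t` is the velocity at time
`t` of its projection to `M`, and the Euler-Lagrange equation `d/dt (∂L/∂v) = ∂L/∂x` holds at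
every time in local coordinates (in one chart around the point or, equivalently, in all). -/
def IsGeodesicFlowLine (φ : FinslerMetric n M) (η : ℝ → TM n M) (s : Set ℝ) : Prop :=
  ContMDiffOn 𝓘(ℝ, ℝ) (𝓡∂ n).tangent 1 η s ∧
  ∀ t ∈ s,
    HasMFDerivWithinAt 𝓘(ℝ, ℝ) (𝓡∂ n) (fun τ => (η τ).proj) s t
      (ContinuousLinearMap.toSpanSingleton ℝ (η t).2) ∧
    ∃ p₀ : M, (η t).proj ∈ (chartAt (EuclideanHalfSpace n) p₀).source ∧
      HasDerivWithinAt (fun τ => dLdv φ p₀ (η τ)) (dLdx φ p₀ (η t)) s t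

/-- The length `∫ φ(σ'(t)) dt` of a curve `σ : [0, 1] → M`. -/
def length (φ : FinslerMetric n M) (σ : ℝ → M) : ℝ :=
  ∫ t in (0 : ℝ)..1,
    φ.toFun ⟨σ t, mfderivWithin 𝓘(ℝ, ℝ) (𝓡∂ n) σ (Icc 0 1) t (1 : ℝ)⟩

/-- `v` is the initial velocity of a unit speed minimizing geodesic from `p` to `q ≠ p`.
When `q` lies in a convex neighbourhood of `p` there is exactly one such `v`. -/
def IsDirectionTo (φ : FinslerMetric n M) (p q : M) (v : TangentSpace (𝓡∂ n) p) : Prop :=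
  ∃ (ℓ : ℝ) (η : ℝ → TM n M), 0 < ℓ ∧ IsGeodesicFlowLine φ η (Icc 0 ℓ) ∧
    (∀ t ∈ Icc 0 ℓ, φ.toFun (η t) = 1) ∧ η 0 = ⟨p, v⟩ ∧ (η ℓ).proj = q ∧
    ∀ σ : ℝ → M, ContMDiffOn 𝓘(ℝ, ℝ) (𝓡∂ n) 1 σ (Icc 0 1) → σ 0 = p → σ 1 = q →
      ℓ ≤ length φ σ

/-- `w` is the dual one form to the vector `V ∈ T_p M`: `w(V) = φ(V)²`, and `w` vanishes on the
hyperplane tangent at `V` to the level set of `φ` through `V`. -/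
def IsDualForm (φ : FinslerMetric n M) (p : M) (V : TangentSpace (𝓡∂ n) p)
    (w : TangentSpace (𝓡∂ n) p →L[ℝ] ℝ) : Prop :=
  w V = φ.toFun ⟨p, V⟩ ^ 2 ∧
  ∀ W : TangentSpace (𝓡∂ n) p,
    HasDerivAt (fun t : ℝ => φ.toFun ⟨p, V + t • W⟩) 0 0 → w W = 0

/-- `Γ` points to the inside of `M` at the boundary point `x`. -/
def PointsInside (Γ : (x : M) → TangentSpace (𝓡∂ n) x) (x : M) : Prop :=
  let V : EuclideanSpace ℝ (Fin n) :=
    mfderiv (𝓡∂ n) 𝓘(ℝ, EuclideanSpace ℝ (Fin n)) (extChartAt (𝓡∂ n) x) x (Γ x)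
  0 < V 0

/-! ### Split loci -/

/-- The union `A(S)` of the integral segments of the geodesic vector field with initial point
in `Γ(∂M)` whose projections do not meet `S`. Only the values of `Γ` on `∂M` matter. -/
def rays (φ : FinslerMetric n M) (Γ : (x : M) → TangentSpace (𝓡∂ n) x) (S : Set M) :
    Set (TM n M) :=
  {z | ∃ x ∈ (𝓡∂ n).boundary M, ∃ (T : ℝ) (η : ℝ → TM n M), 0 ≤ T ∧
    IsGeodesicFlowLine φ η (Icc 0 T) ∧ η 0 = ⟨x, Γ x⟩ ∧
    (∀ t ∈ Icc 0 T, (η t).proj ∉ S) ∧ η T = z}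

/-- `S` splits the (open) manifold: every point of the interior that is not in `S` is reached by
exactly one element of `A(S)`. -/
def Splits (φ : FinslerMetric n M) (Γ : (x : M) → TangentSpace (𝓡∂ n) x) (S : Set M) : Prop :=
  BijOn (fun z : TM n M => z.proj)
    (rays φ Γ S ∩ {z | z.proj ∈ (𝓡∂ n).interior M}) ((𝓡∂ n).interior M \ S)

/-- The set `R_p`. For `p ∉ S` it consists of the velocity at `p` of the ray of `A(S)` that
reaches `p` (the vector `dF_x(r_x)` is `x` itself, because `F` is the restriction of the projection
`TM → M` and `r` is a second order vector field). For `p ∈ S` it is the set of limits in `TM` of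
vectors in `R_q`, for `q ∉ S`, that lie in `T_p M`. -/
def R (φ : FinslerMetric n M) (Γ : (x : M) → TangentSpace (𝓡∂ n) x) (S : Set M) (p : M) :
    Set (TangentSpace (𝓡∂ n) p) :=
  {X | (p ∉ S ∧ (⟨p, X⟩ : TM n M) ∈ rays φ Γ S) ∨
    (p ∈ S ∧ ∃ z : ℕ → TM n M,
      (∀ i, z i ∈ rays φ Γ S ∧ (z i).proj ∈ (𝓡∂ n).interior M \ S) ∧
      Tendsto z atTop (𝓝 (⟨p, X⟩ : TM n M)))}

/-- The set `R*_p` of the one forms dual to the vectors in `R_p`. -/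
def Rdual (φ : FinslerMetric n M) (Γ : (x : M) → TangentSpace (𝓡∂ n) x) (S : Set M) (p : M) :
    Set (TangentSpace (𝓡∂ n) p →L[ℝ] ℝ) :=
  {w | ∃ X ∈ R φ Γ S p, IsDualForm φ p X w}

/-- A split locus: a subset of the open manifold that splits it and is the closure, relative to
the open manifold, of the set of its points `p` such that `R_p` has at least two elements. -/
structure IsSplitLocus (φ : FinslerMetric n M) (Γ : (x : M) → TangentSpace (𝓡∂ n) x)
    (S : Set M) : Prop where
  subset_interior : S ⊆ (𝓡∂ n).interior M
  splits : Splits φ Γ S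
  eq_closure : S = closure {p ∈ S | (R φ Γ S p).Nontrivial} ∩ (𝓡∂ n).interior M

/-- `S` is balanced at `p`: whenever points `pₙ` converge to `p`, the directions `v_{pₙ}(p)`
converge to `v` and vectors `Xₙ ∈ R_{pₙ}` converge to `X ∈ R_p`, the dual form of `X` attains at `v`
the maximum of `w(v)` over `w ∈ R*_p`. -/
def IsBalancedAt (φ : FinslerMetric n M) (Γ : (x : M) → TangentSpace (𝓡∂ n) x) (S : Set M)
    (p : M) : Prop :=
  ∀ (q : ℕ → M) (u X : (i : ℕ) → TangentSpace (𝓡∂ n) (q i)) (v X' : TangentSpace (𝓡∂ n) p),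
    Tendsto q atTop (𝓝 p) →
    (∀ i, IsDirectionTo φ (q i) p (u i)) →
    Tendsto (fun i => (⟨q i, u i⟩ : TM n M)) atTop (𝓝 (⟨p, v⟩ : TM n M)) →
    (∀ i, X i ∈ R φ Γ S (q i)) → X' ∈ R φ Γ S p →
    Tendsto (fun i => (⟨q i, X i⟩ : TM n M)) atTop (𝓝 (⟨p, X'⟩ : TM n M)) →
    ∀ w' : TangentSpace (𝓡∂ n) p →L[ℝ] ℝ, IsDualForm φ p X' w' →
      IsGreatest ((fun w : TangentSpace (𝓡∂ n) p →L[ℝ] ℝ => w v) '' Rdual φ Γ S p) (w' v)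

/-- A balanced split locus. -/
def IsBalancedSplitLocus (φ : FinslerMetric n M) (Γ : (x : M) → TangentSpace (𝓡∂ n) x)
    (S : Set M) : Prop :=
  IsSplitLocus φ Γ S ∧ ∀ p ∈ S, IsBalancedAt φ Γ S p

/-! ### Rectifiability -/

/-- A subset of `ℝⁿ` covered by countably many Lipschitz images of `ℝᵈ`. No exceptional set of
zero `d`-dimensional measure is left out, so this implies the notion in which one is allowed. -/
def IsRectifiableEuclidean (d : ℕ) (A : Set (EuclideanSpace ℝ (Fin n))) : Prop :=
  ∃ f : ℕ → EuclideanSpace ℝ (Fin d) → EuclideanSpace ℝ (Fin n),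
    (∀ i, ∃ K, LipschitzWith K (f i)) ∧ A ⊆ ⋃ i, range (f i)

/-- A subset of the manifold is (countably) `d`-rectifiable if it is so in every chart. -/
def IsRectifiable (d : ℕ) (A : Set M) : Prop :=
  ∀ p₀ : M, IsRectifiableEuclidean d
    (extChartAt (𝓡∂ n) p₀ '' (A ∩ (chartAt (EuclideanHalfSpace n) p₀).source))

end SplitLocus

end

/-!
The dimension of `co (R*_p)` controls how many directions are tangent to the split locus at `p`.
Suppose that points `qᵢ` of the locus converge to `p`, that vectors `Xᵢ, Yᵢ ∈ R_{qᵢ}` converge to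
`X, Y ∈ R_p`, and that the directions from `qᵢ` to `p` converge to `v`. The balance condition says
that the dual forms of `X` and of `Y` both attain the maximum of `R*_p` at `v`, so their difference
vanishes at `v`. If every `R*_{qᵢ}` contains `k` pairs with linearly independent differences, of
bounded size and uniformly independent, then the limit differences are `k` independent vectors of
the direction space of `co (R*_p)`. When that space has dimension exactly `k` they span it, so `v`
lies in its annihilator, of dimension `n - k`
(`IsBalancedSplitLocus.apply_eq_zero_of_tangent`). The points at which `co (R*_p)` has dimension
`k` form countably many strata of this uniform kind (`spreadStratum`), and a set whose tangent
directions at each of its points lie in a `d`-dimensional subspace is covered by countably many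
Lipschitz images of `ℝᵈ` (`isRectifiableEuclidean_of_tangent`).

The balance condition speaks about minimizing geodesics from `qᵢ` to `p`, and the argument needs
that these exist and that their directions are asymptotic to the directions of straight segments in
a chart (`exists_isDirectionTo`). The geodesic is the fixed point of a contraction of the space of
velocity curves (`exists_boundaryValueSolution`). It is minimizing because the Lagrangian `φ² / 2`
is uniformly convex on the fibres: its Weierstrass excess is bounded below by
`c |w - v|² - C |y - x|²`, and on a short time interval the second term is absorbed by the first
after integration (`IsFinslerLagrangian.exists_length_minimizing`). Curves that leave a small ball
are longer (`mem_closedBall_or_le_length`).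

The zero vector, to which every one form is dual, is excluded from `R_p` by the balance condition
itself, since the set of all one forms has no maximum on a nonzero vector
(`IsBalancedSplitLocus.zero_notMem_R`). Every other vector has exactly one dual form, its momentum
`∂L/∂v` (`isDualForm_iff`).
-/

noncomputable section

namespace SplitLocus

/-! ### Short boundary value problems -/

section BoundaryValueProblem

variable {E : Type*} [NormedAddCommGroup E] [NormedSpace ℝ E] [FiniteDimensional ℝ E]

open intervalIntegral in
/-- The equation `x'' = G(x, x')` with boundary values `x(0) = p - δ e'` and `x(δ) = p` has a
solution of velocity close to `e'` when `δ` is small. After rescaling time to `[0, 1]`, the velocity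
is a fixed point of the map that integrates `δ G` along a velocity curve and corrects the mean value
to be `e'`; this map is a contraction for small `δ`. -/
theorem exists_boundaryValueSolution_of_lipschitz {G : E × E → E} {K : NNReal}
    (hG : LipschitzWith K G) (p e : E) :
    ∃ C > 0, ∃ δ₀ > 0, ∀ (δ : ℝ) (e' : E), 0 < δ → δ < δ₀ → ‖e' - e‖ < 1 →
      ∃ x v : ℝ → E, x 0 = p - δ • e' ∧ x δ = p ∧ ∀ t ∈ Icc 0 δ,
        HasDerivAt x (v t) t ∧ HasDerivAt v (G (x t, v t)) t ∧
        ‖x t - p‖ ≤ C * δ ∧ ‖v t - e'‖ ≤ C * δ := by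
  set m : ℝ := ‖G (p, e)‖ + K * (‖e‖ + 2) with hm
  have hm0 : 0 ≤ m := by positivity
  refine ⟨2 * ‖e‖ + 2 + 4 * m, by positivity, 1 / (4 * K + 1), by positivity, ?_⟩
  intro δ e' hδ hδ₀ he'
  have hK0 : (0 : ℝ) ≤ K := K.2
  have hδ1 : δ ≤ 1 := by
    have : 1 / (4 * (K : ℝ) + 1) ≤ 1 := by
      rw [div_le_one (by positivity)]; linarith
    linarith
  have hδK : 2 * δ * K ≤ 1 / 2 := by
    rw [lt_div_iff₀ (by positivity)] at hδ₀
    nlinarith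
  have he'n : ‖e'‖ ≤ ‖e‖ + 1 := by
    have := norm_add_le (e' - e) e
    simp only [sub_add_cancel] at this
    linarith
  let ext (u : C(unitInterval, E)) : ℝ → E := Set.IccExtend zero_le_one u
  have hext (u) : Continuous (ext u) := u.continuous.Icc_extend'
  have hextI (u) (t : ℝ) (ht : t ∈ Icc (0 : ℝ) 1) : ext u t = u ⟨t, ht⟩ :=
    Set.IccExtend_of_mem _ _ ht
  have hextd (u w) (t : ℝ) : ‖ext u t - ext w t‖ ≤ dist u w := by
    rw [← dist_eq_norm]; exact ContinuousMap.dist_apply_le_dist _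
  -- the curve with velocity `u`, the integrated acceleration `F`, and the new velocity `Y`
  let X (u : C(unitInterval, E)) (t : ℝ) : E := (p - δ • e') + δ • ∫ s in (0 : ℝ)..t, ext u s
  have hX (u) (t : ℝ) : HasDerivAt (X u) (δ • ext u t) t :=
    (((hext u).integral_hasStrictDerivAt 0 t).hasDerivAt.const_smul δ).const_add _
  have hXc (u) : Continuous (X u) :=
    continuous_iff_continuousAt.2 fun t => (hX u t).continuousAt
  let A (u : C(unitInterval, E)) (t : ℝ) : E := G (X u t, ext u t)
  have hA (u) : Continuous (A u) := hG.continuous.comp ((hXc u).prodMk (hext u))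
  let F (u : C(unitInterval, E)) (t : ℝ) : E := ∫ s in (0 : ℝ)..t, A u s
  have hF (u) (t : ℝ) : HasDerivAt (F u) (A u t) t :=
    ((hA u).integral_hasStrictDerivAt 0 t).hasDerivAt
  have hFc (u) : Continuous (F u) :=
    continuous_iff_continuousAt.2 fun t => (hF u t).continuousAt
  let Y (u : C(unitInterval, E)) (t : ℝ) : E := e' + δ • (F u t - ∫ s in (0 : ℝ)..1, F u s)
  have hY (u) (t : ℝ) : HasDerivAt (Y u) (δ • A u t) t :=
    (((hF u t).sub_const _).const_smul δ).const_add _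
  have hYc (u) : Continuous (Y u) :=
    continuous_iff_continuousAt.2 fun t => (hY u t).continuousAt
  let T (u : C(unitInterval, E)) : C(unitInterval, E) :=
    ⟨fun t => Y u t, (hYc u).comp continuous_subtype_val⟩
  -- integrals over subintervals of `[0, 1]` of functions bounded by `c`
  have hint (f : ℝ → E) (c : ℝ) (hc : ∀ s ∈ Icc (0 : ℝ) 1, ‖f s‖ ≤ c) (hc0 : 0 ≤ c) (t : ℝ)
      (ht : t ∈ Icc (0 : ℝ) 1) : ‖∫ s in (0 : ℝ)..t, f s‖ ≤ c := by
    have := norm_integral_le_of_norm_le_const (a := 0) (b := t) (f := f) (C := c) (by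
      intro s hs
      rw [uIoc_of_le ht.1] at hs
      exact hc s ⟨hs.1.le, hs.2.trans ht.2⟩)
    rw [sub_zero, abs_of_nonneg ht.1] at this
    nlinarith [ht.2]
  have hone : (1 : ℝ) ∈ Icc (0 : ℝ) 1 := by simp
  have hcontr : ContractingWith (1 / 2) T := by
    refine ⟨by rw [← NNReal.coe_lt_coe]; norm_num, LipschitzWith.of_dist_le_mul fun u w => ?_⟩
    set d := dist u w
    have hd : 0 ≤ d := dist_nonneg
    have h1 : ∀ t ∈ Icc (0 : ℝ) 1, ‖X u t - X w t‖ ≤ d := by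
      intro t ht
      have : X u t - X w t = δ • ∫ s in (0 : ℝ)..t, (ext u s - ext w s) := by
        rw [integral_sub ((hext u).intervalIntegrable _ _) ((hext w).intervalIntegrable _ _)]
        simp only [X]; module
      rw [this, norm_smul, Real.norm_of_nonneg hδ.le]
      have := hint (fun s => ext u s - ext w s) d (fun s _ => hextd u w s) hd t ht
      nlinarith [norm_nonneg (∫ s in (0 : ℝ)..t, (ext u s - ext w s))]
    have h2 : ∀ t ∈ Icc (0 : ℝ) 1, ‖A u t - A w t‖ ≤ K * d := by
      intro t ht
      rw [← dist_eq_norm]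
      refine (hG.dist_le_mul _ _).trans (mul_le_mul_of_nonneg_left ?_ hK0)
      rw [Prod.dist_eq, dist_eq_norm, dist_eq_norm]
      exact max_le (h1 t ht) (hextd u w t)
    have h3 : ∀ t ∈ Icc (0 : ℝ) 1, ‖F u t - F w t‖ ≤ K * d := by
      intro t ht
      have : F u t - F w t = ∫ s in (0 : ℝ)..t, (A u s - A w s) :=
        (integral_sub ((hA u).intervalIntegrable _ _) ((hA w).intervalIntegrable _ _)).symm
      rw [this]
      exact hint _ _ h2 (by positivity) t ht
    have h4 : ‖(∫ s in (0 : ℝ)..1, F u s) - ∫ s in (0 : ℝ)..1, F w s‖ ≤ K * d := by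
      rw [← integral_sub ((hFc u).intervalIntegrable _ _) ((hFc w).intervalIntegrable _ _)]
      exact hint _ _ h3 (by positivity) 1 hone
    rw [ContinuousMap.dist_le (by positivity)]
    intro t
    have : Y u t - Y w t = δ • ((F u t - F w t) -
        ((∫ s in (0 : ℝ)..1, F u s) - ∫ s in (0 : ℝ)..1, F w s)) := by
      simp only [Y]; module
    change dist (Y u t) (Y w t) ≤ _
    rw [dist_eq_norm, this, norm_smul, Real.norm_of_nonneg hδ.le]
    have h5 := norm_sub_le (F u t - F w t)
      ((∫ s in (0 : ℝ)..1, F u s) - ∫ s in (0 : ℝ)..1, F w s)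
    have h6 := h3 t t.2
    calc _ ≤ δ * (K * d + K * d) := by gcongr; linarith
      _ = 2 * δ * K * d := by ring
      _ ≤ (1 / 2) * d := by gcongr
      _ = _ := by norm_num
  set u₀ : C(unitInterval, E) := ContinuousMap.const _ e'
  set v₀ := ContractingWith.fixedPoint T hcontr
  have hfix : T v₀ = v₀ := hcontr.fixedPoint_isFixedPt
  have hfixI (t : ℝ) (ht : t ∈ Icc (0 : ℝ) 1) : ext v₀ t = Y v₀ t := by
    rw [hextI v₀ t ht]
    conv_lhs => rw [← hfix]
    rfl
  have hdist : dist u₀ v₀ ≤ 4 * m * δ := by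
    have h1 := hcontr.dist_fixedPoint_le u₀
    have h2 : dist u₀ (T u₀) ≤ 2 * δ * m := by
      have hext0 (t : ℝ) : ext u₀ t = e' := rfl
      have hX0 (t : ℝ) : X u₀ t = p - (δ * (1 - t)) • e' := by
        simp only [X, hext0, integral_const, sub_zero]; module
      have hA0 : ∀ t ∈ Icc (0 : ℝ) 1, ‖A u₀ t‖ ≤ m := by
        intro t ht
        have h3 := hG.dist_le_mul (X u₀ t, ext u₀ t) (p, e)
        have h4 : dist (X u₀ t, ext u₀ t) (p, e) ≤ ‖e‖ + 2 := by
          rw [Prod.dist_eq, hX0, hext0, dist_eq_norm, dist_eq_norm]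
          refine max_le ?_ (by linarith [norm_nonneg e])
          have : p - (δ * (1 - t)) • e' - p = -((δ * (1 - t)) • e') := by module
          have ht1 : 0 ≤ 1 - t := by linarith [ht.2]
          rw [this, norm_neg, norm_smul, Real.norm_of_nonneg (by positivity)]
          have : δ * (1 - t) ≤ 1 := by nlinarith [ht.1]
          nlinarith [norm_nonneg e']
        have h5 := norm_add_le (G (X u₀ t, ext u₀ t) - G (p, e)) (G (p, e))
        rw [sub_add_cancel, ← dist_eq_norm] at h5
        have h6 := mul_le_mul_of_nonneg_left h4 hK0
        change ‖G (X u₀ t, ext u₀ t)‖ ≤ m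
        linarith
      have hF0 : ∀ t ∈ Icc (0 : ℝ) 1, ‖F u₀ t‖ ≤ m := fun t ht => hint _ _ hA0 hm0 t ht
      have hM0 := hint _ _ hF0 hm0 1 hone
      rw [ContinuousMap.dist_le (by positivity)]
      intro t
      change dist e' (Y u₀ t) ≤ _
      rw [dist_comm, dist_eq_norm]
      have : Y u₀ t - e' = δ • (F u₀ t - ∫ s in (0 : ℝ)..1, F u₀ s) := by simp only [Y]; module
      rw [this, norm_smul, Real.norm_of_nonneg hδ.le]
      have h5 := norm_sub_le (F u₀ t) (∫ s in (0 : ℝ)..1, F u₀ s)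
      have h6 := hF0 t t.2
      calc _ ≤ δ * (m + m) := by gcongr; linarith
        _ = _ := by ring
    have h3 : (1 : ℝ) - ((1 / 2 : NNReal) : ℝ) = 1 / 2 := by norm_num
    rw [h3] at h1
    change dist u₀ v₀ ≤ _ at h1
    linarith [div_le_div_of_nonneg_right h2 (by norm_num : (0 : ℝ) ≤ 1 / 2)]
  have hvI (t : ℝ) : ‖ext v₀ t - e'‖ ≤ 4 * m * δ := by
    have := hextd u₀ v₀ t
    rw [← norm_neg, neg_sub]
    exact this.trans hdist
  have hmean : ∫ s in (0 : ℝ)..1, ext v₀ s = e' := by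
    have h1 : ∫ s in (0 : ℝ)..1, ext v₀ s = ∫ s in (0 : ℝ)..1, Y v₀ s := by
      refine integral_congr fun s hs => ?_
      rw [uIcc_of_le zero_le_one] at hs
      exact hfixI s hs
    rw [h1]
    simp only [Y]
    rw [integral_add (by simp) (by
        exact (((hFc v₀).sub continuous_const).const_smul δ).intervalIntegrable _ _),
      integral_smul, integral_sub ((hFc v₀).intervalIntegrable _ _) (by simp)]
    simp
  have hdiv (t : ℝ) : HasDerivAt (fun t : ℝ => t / δ) (1 / δ) t := (hasDerivAt_id t).div_const δ
  refine ⟨fun t => X v₀ (t / δ), fun t => Y v₀ (t / δ), ?_, ?_, ?_⟩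
  · simp [X]
  · simp only [div_self hδ.ne', X, hmean]; module
  · intro t ht
    have ht' : t / δ ∈ Icc (0 : ℝ) 1 :=
      ⟨div_nonneg ht.1 hδ.le, (div_le_one hδ).2 ht.2⟩
    refine ⟨?_, ?_, ?_, ?_⟩
    · have := (hX v₀ (t / δ)).scomp t (hdiv t)
      rw [hfixI _ ht', smul_smul, one_div, inv_mul_cancel₀ hδ.ne', one_smul] at this
      exact this
    · have := (hY v₀ (t / δ)).scomp t (hdiv t)
      simp only [A] at this
      rw [hfixI _ ht', smul_smul, one_div, inv_mul_cancel₀ hδ.ne', one_smul] at this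
      exact this
    · have h1 : ‖∫ s in (0 : ℝ)..(t / δ), ext v₀ s‖ ≤ ‖e‖ + 1 + 4 * m * δ := by
        refine hint _ _ (fun s _ => ?_) (by positivity) _ ht'
        have := norm_add_le (ext v₀ s - e') e'
        rw [sub_add_cancel] at this
        linarith [hvI s]
      have h2 : X v₀ (t / δ) - p = δ • ((∫ s in (0 : ℝ)..(t / δ), ext v₀ s) - e') := by
        simp only [X]; module
      simp only
      rw [h2, norm_smul, Real.norm_of_nonneg hδ.le, mul_comm]
      gcongr
      have := norm_sub_le (∫ s in (0 : ℝ)..(t / δ), ext v₀ s) e'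
      nlinarith
    · have := hvI (t / δ)
      rw [hfixI _ ht'] at this
      nlinarith [norm_nonneg e]

/-- The local version for a `C¹` right hand side. The solution stays in the region where the right
hand side agrees with a globally Lipschitz extension. -/
theorem exists_boundaryValueSolution {G : E × E → E} {p e : E} (hG : ContDiffAt ℝ 1 G (p, e)) :
    ∃ C > 0, ∃ δ₀ > 0, ∀ (δ : ℝ) (e' : E), 0 < δ → δ < δ₀ → ‖e' - e‖ < δ₀ →
      ∃ x v : ℝ → E, x 0 = p - δ • e' ∧ x δ = p ∧ ∀ t ∈ Icc 0 δ,
        HasDerivAt x (v t) t ∧ HasDerivAt v (G (x t, v t)) t ∧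
        ‖x t - p‖ ≤ C * δ ∧ ‖v t - e'‖ ≤ C * δ := by
  obtain ⟨K, s, hs, hGs⟩ := hG.exists_lipschitzOnWith
  obtain ⟨G', hG', hGG'⟩ := hGs.extend_finite_dimension
  obtain ⟨ρ, hρ, hρs⟩ := Metric.mem_nhds_iff.1 hs
  obtain ⟨C, hC, δ₁, hδ₁, H⟩ := exists_boundaryValueSolution_of_lipschitz hG' p e
  refine ⟨C, hC, min (min δ₁ 1) (ρ / (C + 1)), by positivity, fun δ e' hδ hδ₀ he' => ?_⟩
  simp only [lt_min_iff] at hδ₀ he'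
  obtain ⟨x, v, h0, h1, hxv⟩ := H δ e' hδ hδ₀.1.1 he'.1.2
  refine ⟨x, v, h0, h1, fun t ht => ?_⟩
  obtain ⟨a, b, c, d⟩ := hxv t ht
  refine ⟨a, ?_, c, d⟩
  have hb : C * δ < ρ * (C / (C + 1)) := by
    calc C * δ < C * (ρ / (C + 1)) := by gcongr; exact hδ₀.2
      _ = _ := by ring
  have hb2 : ρ * (C / (C + 1)) + ρ / (C + 1) = ρ := by field_simp
  have hb3 : 0 < ρ / (C + 1) := by positivity
  rwa [hGG' (hρs _)]
  rw [Metric.mem_ball, Prod.dist_eq, max_lt_iff, dist_eq_norm, dist_eq_norm]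
  refine ⟨by simp only; linarith, ?_⟩
  have := norm_add_le (v t - e') (e' - e)
  rw [sub_add_sub_cancel] at this
  simp only
  linarith [he'.2]

end BoundaryValueProblem

/-! ### Sets with small tangent spaces are rectifiable -/

section Rectifiability

variable {n : ℕ} {d : ℕ}

theorem IsRectifiableEuclidean.mono {A B : Set (EuclideanSpace ℝ (Fin n))} (hAB : A ⊆ B)
    (hB : IsRectifiableEuclidean d B) : IsRectifiableEuclidean d A := by
  obtain ⟨f, hf, h⟩ := hB
  exact ⟨f, hf, hAB.trans h⟩

theorem IsRectifiableEuclidean.iUnion {ι : Type*} [Countable ι]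
    {A : ι → Set (EuclideanSpace ℝ (Fin n))} (hA : ∀ i, IsRectifiableEuclidean d (A i)) :
    IsRectifiableEuclidean d (⋃ i, A i) := by
  choose f hf hAf using hA
  rcases isEmpty_or_nonempty ι with hι | hι
  · exact ⟨fun _ _ => 0, fun _ => ⟨0, LipschitzWith.const 0⟩, by simp⟩
  · obtain ⟨e, he⟩ := exists_surjective_nat (ι × ℕ)
    refine ⟨fun j => f (e j).1 (e j).2, fun j => hf _ _, iUnion_subset fun i x hx => ?_⟩
    obtain ⟨m, hm⟩ := mem_iUnion.1 (hAf i hx)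
    obtain ⟨j, hj⟩ := he (i, m)
    exact mem_iUnion.2 ⟨j, by simpa [hj] using hm⟩

/-- A set on which a linear map to `ℝᵈ` has a Lipschitz inverse is a Lipschitz image of a subset
of `ℝᵈ`, and the inverse extends to all of `ℝᵈ`. -/
theorem isRectifiableEuclidean_of_norm_le {A : Set (EuclideanSpace ℝ (Fin n))}
    (Q : EuclideanSpace ℝ (Fin n) →L[ℝ] EuclideanSpace ℝ (Fin d)) (C : NNReal)
    (h : ∀ x ∈ A, ∀ y ∈ A, ‖x - y‖ ≤ C * ‖Q (x - y)‖) : IsRectifiableEuclidean d A := by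
  have hinj : InjOn Q A := by
    intro x hx y hy hxy
    have := h x hx y hy
    rw [map_sub, hxy, sub_self, norm_zero, mul_zero] at this
    exact sub_eq_zero.1 (norm_le_zero_iff.1 this)
  have hlip : LipschitzOnWith C (Function.invFunOn Q A) (Q '' A) := by
    refine LipschitzOnWith.of_dist_le_mul ?_
    rintro _ ⟨x, hx, rfl⟩ _ ⟨y, hy, rfl⟩
    rw [hinj.leftInvOn_invFunOn hx, hinj.leftInvOn_invFunOn hy, dist_eq_norm, dist_eq_norm,
      ← map_sub]
    exact h x hx y hy
  obtain ⟨g, hg, hgA⟩ := hlip.extend_finite_dimension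
  refine ⟨fun _ => g, fun _ => ⟨_, hg⟩, fun x hx => mem_iUnion.2 ⟨0, Q x, ?_⟩⟩
  exact (hgA (mem_image_of_mem _ hx)).symm.trans (hinj.leftInvOn_invFunOn hx)

/-- A subspace of dimension at most `d` is mapped injectively to `ℝᵈ` by some linear map. -/
theorem exists_continuousLinearMap_norm_le (N : Submodule ℝ (EuclideanSpace ℝ (Fin n)))
    (hN : Module.finrank ℝ N ≤ d) :
    ∃ (Q : EuclideanSpace ℝ (Fin n) →L[ℝ] EuclideanSpace ℝ (Fin d)) (c : ℝ), 0 < c ∧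
      ∀ v ∈ N, c * ‖v‖ ≤ ‖Q v‖ := by
  obtain ⟨f, hf⟩ : ∃ f : N →ₗ[ℝ] EuclideanSpace ℝ (Fin d), Function.Injective f :=
    finrank_le_iff_exists_linearMap.1 (by simpa using hN)
  obtain ⟨g, hg⟩ := f.exists_extend
  obtain ⟨K, hK, hKf⟩ := f.exists_antilipschitzWith (LinearMap.ker_eq_bot.2 hf)
  refine ⟨LinearMap.toContinuousLinearMap g, (K : ℝ)⁻¹, by positivity, fun v hv => ?_⟩
  have h1 := hKf.le_mul_dist ⟨v, hv⟩ 0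
  simp only [map_zero, dist_zero_right, Submodule.coe_norm] at h1
  have h2 : g v = f ⟨v, hv⟩ := by rw [← hg]; rfl
  rw [LinearMap.coe_toContinuousLinearMap', h2]
  rw [inv_mul_le_iff₀ (by positivity)]
  exact h1

/-- A set whose tangent directions at every point `p` lie in a linear subspace `N p` of dimension
at most `d` is countably `d`-rectifiable. Near `p`, a linear map `Q` to `ℝᵈ` that is injective on
`N p` satisfies `|y - p| ≤ C |Q (y - p)|` for `y ∈ A`; since this is an open condition on `Q`, the
maps `Q`, the constants and the scales can be taken from countable families. -/
theorem isRectifiableEuclidean_of_tangent {A : Set (EuclideanSpace ℝ (Fin n))}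
    (h : ∀ p ∈ A, ∃ N : Submodule ℝ (EuclideanSpace ℝ (Fin n)), Module.finrank ℝ N ≤ d ∧
      ∀ (y : ℕ → EuclideanSpace ℝ (Fin n)) (v : EuclideanSpace ℝ (Fin n)),
        (∀ i, y i ∈ A ∧ y i ≠ p) → Tendsto y atTop (𝓝 p) →
        Tendsto (fun i => ‖y i - p‖⁻¹ • (y i - p)) atTop (𝓝 v) → v ∈ N) :
    IsRectifiableEuclidean d A := by
  let Q := TopologicalSpace.denseSeq (EuclideanSpace ℝ (Fin n) →L[ℝ] EuclideanSpace ℝ (Fin d))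
  let z := TopologicalSpace.denseSeq (EuclideanSpace ℝ (Fin n))
  let B (i : ℕ × ℕ × ℕ) : Set (EuclideanSpace ℝ (Fin n)) :=
    {p ∈ A | (∀ y ∈ A, ‖y - p‖ < 1 / (i.2.1 + 1) → ‖y - p‖ ≤ (i.2.1 + 1) * ‖Q i.1 (y - p)‖) ∧
      dist p (z i.2.2) < 1 / (i.2.1 + 1) / 2}
  refine IsRectifiableEuclidean.mono ?_ (IsRectifiableEuclidean.iUnion (A := B) fun i => ?_)
  -- the number `m` stands both for the constant `m + 1` and for the scale `1 / (m + 1)`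
  · intro p hp
    obtain ⟨N, hN, hNA⟩ := h p hp
    obtain ⟨Q₀, c, hc, hQ₀⟩ := exists_continuousLinearMap_norm_le N hN
    obtain ⟨a, ha⟩ := (TopologicalSpace.denseRange_denseSeq
      (EuclideanSpace ℝ (Fin n) →L[ℝ] EuclideanSpace ℝ (Fin d))).exists_dist_lt Q₀ hc
    change dist Q₀ (Q a) < c at ha
    have hinj : ∀ v ∈ N, Q a v = 0 → v = 0 := by
      intro v hv hv0
      by_contra hne
      have h1 := (Q₀ - Q a).le_opNorm v
      rw [sub_apply, hv0, sub_zero, ← dist_eq_norm] at h1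
      have h2 := hQ₀ v hv
      have h3 : 0 < ‖v‖ := norm_pos_iff.2 hne
      nlinarith
    obtain ⟨m, hm⟩ : ∃ m : ℕ, ∀ y ∈ A, ‖y - p‖ < 1 / (m + 1) →
        ‖y - p‖ ≤ (m + 1) * ‖Q a (y - p)‖ := by
      by_contra! hcon
      choose y hyA hy1 hy2 using hcon
      have hne : ∀ i, y i ≠ p := by
        intro i hi
        have := hy2 i
        simp [hi] at this
      have hlim : Tendsto y atTop (𝓝 p) := by
        rw [tendsto_iff_norm_sub_tendsto_zero]
        exact squeeze_zero (fun _ => norm_nonneg _) (fun i => (hy1 i).le)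
          tendsto_one_div_add_atTop_nhds_zero_nat
      have hpos (i) : 0 < ‖y i - p‖ := norm_pos_iff.2 (sub_ne_zero.2 (hne i))
      have hsph : ∀ i, ‖y i - p‖⁻¹ • (y i - p) ∈
          Metric.sphere (0 : EuclideanSpace ℝ (Fin n)) 1 := by
        intro i
        rw [mem_sphere_zero_iff_norm, norm_smul, norm_inv, norm_norm,
          inv_mul_cancel₀ (hpos i).ne']
      obtain ⟨v, hv, ψ, hψ, hvlim⟩ := (isCompact_sphere _ _).tendsto_subseq hsph
      have hvN : v ∈ N := hNA (y ∘ ψ) v (fun i => ⟨hyA _, hne _⟩)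
        (hlim.comp hψ.tendsto_atTop) hvlim
      have hQv : Q a v = 0 := by
        refine tendsto_nhds_unique (((Q a).continuous.tendsto v).comp hvlim) ?_
        have h0 : Tendsto (fun i => Q a (‖y i - p‖⁻¹ • (y i - p))) atTop (𝓝 0) := by
          refine squeeze_zero_norm (fun i => ?_) tendsto_one_div_add_atTop_nhds_zero_nat
          rw [map_smul, norm_smul, norm_inv, norm_norm, inv_mul_le_iff₀ (hpos i), mul_one_div,
            le_div_iff₀ (by positivity), mul_comm]
          exact (hy2 i).le
        exact h0.comp hψ.tendsto_atTop
      have : v = 0 := hinj v hvN hQv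
      simp [this] at hv
    obtain ⟨b, hb⟩ := (TopologicalSpace.denseRange_denseSeq
      (EuclideanSpace ℝ (Fin n))).exists_dist_lt p
        (show (0 : ℝ) < 1 / ((m : ℝ) + 1) / 2 by positivity)
    exact mem_iUnion.2 ⟨(a, m, b), hp, hm, hb⟩
  · refine isRectifiableEuclidean_of_norm_le (Q i.1) (i.2.1 + 1) fun x hx y hy => ?_
    have := hy.2.1 x hx.1 (by
      rw [← dist_eq_norm]
      linarith [dist_triangle_right x y (z i.2.2), hx.2.2, hy.2.2])
    simpa using this

end Rectifiability

/-! ### The calculus of a Finsler Lagrangian -/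

section Lagrangian

variable {E : Type*} [NormedAddCommGroup E] [NormedSpace ℝ E]

/-- `L(x, v)` is half the square of a Finsler metric on the open subset `U` of a vector space.
Smoothness is required for `v ≠ 0` only. -/
structure IsFinslerLagrangian (U : Set E) (L : E → E → ℝ) : Prop where
  isOpen : IsOpen U
  contDiffOn : ContDiffOn ℝ ∞ (Function.uncurry L) (U ×ˢ {0}ᶜ)
  continuousOn : ContinuousOn (Function.uncurry L) (U ×ˢ univ)
  homog : ∀ x ∈ U, ∀ v, ∀ c : ℝ, 0 < c → L x (c • v) = c ^ 2 * L x v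
  pos : ∀ x ∈ U, ∀ v, v ≠ 0 → 0 < L x v
  convex : ∀ x ∈ U, ∀ v w, v ≠ 0 → w ≠ 0 → 0 < iteratedDeriv 2 (fun t : ℝ => L x (v + t • w)) 0

/-- The partial derivative `∂L/∂v`. -/
def momentum (L : E → E → ℝ) (z : E × E) : E →L[ℝ] ℝ :=
  (fderiv ℝ (Function.uncurry L) z).comp (ContinuousLinearMap.inr ℝ E E)

/-- The partial derivative `∂L/∂x`. -/
def force (L : E → E → ℝ) (z : E × E) : E →L[ℝ] ℝ :=
  (fderiv ℝ (Function.uncurry L) z).comp (ContinuousLinearMap.inl ℝ E E)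

/-- The fibre Hessian `∂²L/∂v²`. -/
def fibreHessian (L : E → E → ℝ) (z : E × E) : E →L[ℝ] E →L[ℝ] ℝ :=
  (fderiv ℝ (momentum L) z).comp (ContinuousLinearMap.inr ℝ E E)

/-- The acceleration of the geodesic with velocity `z`: the Euler-Lagrange equation of `L` is
`v' = spray L (x, v)`. `inverse` has its junk value `0` where the Hessian is not invertible, which
happens only outside of the domain of interest. -/
def spray (L : E → E → ℝ) (z : E × E) : E :=
  (fibreHessian L z).inverse (force L z - fderiv ℝ (momentum L) z (z.2, 0))

/-- A continuous function that is positive on `{p} × K`, `K` compact, is bounded below by a positive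
constant on `V × K` for a neighbourhood `V` of `p`. -/
theorem exists_pos_le_of_isCompact {X Y : Type*} [TopologicalSpace X] [TopologicalSpace Y]
    {K : Set Y} (hK : IsCompact K) {f : X × Y → ℝ} {p : X}
    (hf : ∀ k ∈ K, ContinuousAt f (p, k)) (hpos : ∀ k ∈ K, 0 < f (p, k)) :
    ∃ c > 0, ∀ᶠ y in 𝓝 p, ∀ k ∈ K, c ≤ f (y, k) := by
  refine hK.induction_on (p := fun s => ∃ c > 0, ∀ᶠ y in 𝓝 p, ∀ k ∈ s, c ≤ f (y, k))
    ⟨1, one_pos, by simp⟩ ?_ ?_ ?_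
  · rintro s t hst ⟨c, hc, h⟩
    exact ⟨c, hc, h.mono fun y hy k hk => hy k (hst hk)⟩
  · rintro s t ⟨c, hc, h⟩ ⟨c', hc', h'⟩
    refine ⟨min c c', lt_min hc hc', ?_⟩
    filter_upwards [h, h'] with y hy hy' k hk
    rcases hk with hk | hk
    · exact (min_le_left _ _).trans (hy k hk)
    · exact (min_le_right _ _).trans (hy' k hk)
  · intro k hk
    have h1 : ∀ᶠ z in 𝓝 (p, k), f (p, k) / 2 < f z :=
      (hf k hk).eventually (lt_mem_nhds (half_lt_self (hpos k hk)))
    rw [nhds_prod_eq] at h1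
    obtain ⟨pa, ha, pb, hb, h2⟩ := Filter.eventually_prod_iff.1 h1
    exact ⟨{k | pb k}, mem_nhdsWithin_of_mem_nhds hb, f (p, k) / 2, half_pos (hpos k hk),
      ha.mono fun y hy k' hk' => (h2 hy hk').le⟩

/-- A lower bound of the second derivative gives a quadratic lower bound of the function. -/
theorem add_half_le_of_le_deriv2 {f f' f'' : ℝ → ℝ} {m : ℝ}
    (hf : ∀ t ∈ Icc (0 : ℝ) 1, HasDerivAt f (f' t) t)
    (hf' : ∀ t ∈ Icc (0 : ℝ) 1, HasDerivAt f' (f'' t) t)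
    (hm : ∀ t ∈ Icc (0 : ℝ) 1, m ≤ f'' t) : f 0 + f' 0 + m / 2 ≤ f 1 := by
  have h0 : (0 : ℝ) ∈ Icc (0 : ℝ) 1 := by simp
  have h1 : (1 : ℝ) ∈ Icc (0 : ℝ) 1 := by simp
  have key (g g' : ℝ → ℝ) (hg : ∀ t ∈ Icc (0 : ℝ) 1, HasDerivAt g (g' t) t)
      (hg' : ∀ t ∈ Icc (0 : ℝ) 1, 0 ≤ g' t) : MonotoneOn g (Icc 0 1) := by
    refine monotoneOn_of_deriv_nonneg (convex_Icc 0 1)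
      (fun t ht => (hg t ht).continuousAt.continuousWithinAt)
      (fun t ht => (hg t (interior_subset ht)).differentiableAt.differentiableWithinAt)
      fun t ht => ?_
    rw [(hg t (interior_subset ht)).deriv]
    exact hg' t (interior_subset ht)
  have hA := key (fun t => f' t - f' 0 - m * t) (fun t => f'' t - m)
    (fun t ht => (((hf' t ht).sub_const (f' 0)).sub
      ((hasDerivAt_id t).const_mul m)).congr_deriv (by simp))
    (fun t ht => by linarith [hm t ht])
  have hB := key (fun t => f t - f' 0 * t - m / 2 * t ^ 2) (fun t => f' t - f' 0 - m * t)
    (fun t ht => by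
      have := ((hf t ht).sub ((hasDerivAt_id t).const_mul (f' 0))).sub
        (((hasDerivAt_id t).pow 2).const_mul (m / 2))
      refine this.congr_deriv ?_
      simp; ring)
    (fun t ht => by simpa using hA h0 ht ht.1)
  have := hB h0 h1 zero_le_one
  simp at this
  linarith

namespace IsFinslerLagrangian

variable {U : Set E} {L : E → E → ℝ} (hL : IsFinslerLagrangian U L) {x v w : E}

include hL

theorem contDiffAt (hx : x ∈ U) (hv : v ≠ 0) : ContDiffAt ℝ ∞ (Function.uncurry L) (x, v) :=
  hL.contDiffOn.contDiffAt ((hL.isOpen.prod isOpen_compl_singleton).mem_nhds ⟨hx, hv⟩)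

theorem contDiffAt_fderiv (hx : x ∈ U) (hv : v ≠ 0) :
    ContDiffAt ℝ ∞ (fderiv ℝ (Function.uncurry L)) (x, v) :=
  (hL.contDiffAt hx hv).fderiv_right (by norm_cast)

theorem contDiffAt_momentum (hx : x ∈ U) (hv : v ≠ 0) : ContDiffAt ℝ ∞ (momentum L) (x, v) :=
  (hL.contDiffAt_fderiv hx hv).clm_comp contDiffAt_const

theorem contDiffAt_force (hx : x ∈ U) (hv : v ≠ 0) : ContDiffAt ℝ ∞ (force L) (x, v) :=
  (hL.contDiffAt_fderiv hx hv).clm_comp contDiffAt_const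

theorem contDiffAt_fibreHessian (hx : x ∈ U) (hv : v ≠ 0) :
    ContDiffAt ℝ ∞ (fibreHessian L) (x, v) :=
  ((hL.contDiffAt_momentum hx hv).fderiv_right (by norm_cast)).clm_comp contDiffAt_const

theorem hasFDerivAt (hx : x ∈ U) (hv : v ≠ 0) :
    HasFDerivAt (Function.uncurry L) (fderiv ℝ (Function.uncurry L) (x, v)) (x, v) :=
  ((hL.contDiffAt hx hv).differentiableAt (by norm_num)).hasFDerivAt

theorem hasFDerivAt_momentum (hx : x ∈ U) (hv : v ≠ 0) :
    HasFDerivAt (momentum L) (fderiv ℝ (momentum L) (x, v)) (x, v) :=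
  ((hL.contDiffAt_momentum hx hv).differentiableAt (by norm_num)).hasFDerivAt

theorem hasFDerivAt_fibre (hx : x ∈ U) (hv : v ≠ 0) :
    HasFDerivAt (fun v => L x v) (momentum L (x, v)) v :=
  (hL.hasFDerivAt hx hv).comp v (hasFDerivAt_prodMk_right x v)

theorem hasFDerivAt_base (hx : x ∈ U) (hv : v ≠ 0) :
    HasFDerivAt (fun x => L x v) (force L (x, v)) x := by
  have h := hL.hasFDerivAt hx hv
  exact HasFDerivAt.comp (g := Function.uncurry L) (f := fun x => (x, v)) x h
    (hasFDerivAt_prodMk_left x v)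

theorem hasFDerivAt_momentum_fibre (hx : x ∈ U) (hv : v ≠ 0) :
    HasFDerivAt (fun v => momentum L (x, v)) (fibreHessian L (x, v)) v :=
  (hL.hasFDerivAt_momentum hx hv).comp v (hasFDerivAt_prodMk_right x v)

theorem apply_zero (hx : x ∈ U) : L x 0 = 0 := by
  have := hL.homog x hx 0 2 two_pos
  rw [smul_zero] at this
  linarith

theorem nonneg (hx : x ∈ U) (v : E) : 0 ≤ L x v := by
  rcases eq_or_ne v 0 with rfl | hv
  · exact (hL.apply_zero hx).ge
  · exact (hL.pos x hx v hv).le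

theorem hasDerivAt_line (hx : x ∈ U) {t : ℝ} (h : v + t • w ≠ 0) :
    HasDerivAt (fun t : ℝ => L x (v + t • w)) (momentum L (x, v + t • w) w) t := by
  have h1 : HasDerivAt (fun t : ℝ => v + t • w) w t := by
    simpa using ((hasDerivAt_id t).smul_const w).const_add v
  exact (hL.hasFDerivAt_fibre hx h).comp_hasDerivAt t h1

theorem hasDerivAt_momentum_line (hx : x ∈ U) {t : ℝ} (h : v + t • w ≠ 0) :
    HasDerivAt (fun t : ℝ => momentum L (x, v + t • w) w)
      (fibreHessian L (x, v + t • w) w w) t := by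
  have h1 : HasDerivAt (fun t : ℝ => v + t • w) w t := by
    simpa using ((hasDerivAt_id t).smul_const w).const_add v
  have h2 := (hL.hasFDerivAt_momentum_fibre hx h).comp_hasDerivAt t h1
  simpa using h2.clm_apply (hasDerivAt_const t w)

/-- Euler's identity. -/
theorem momentum_apply_self (hx : x ∈ U) (hv : v ≠ 0) : momentum L (x, v) v = 2 * L x v := by
  have h1 := hL.hasDerivAt_line (w := v) hx (t := 0) (by simpa using hv)
  simp only [zero_smul, add_zero] at h1
  have h2 : HasDerivAt (fun t : ℝ => (1 + t) ^ 2 * L x v) (2 * L x v) 0 := by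
    have := (((hasDerivAt_id (0 : ℝ)).const_add 1).pow 2).mul_const (L x v)
    simpa using this
  refine h1.unique (h2.congr_of_eventuallyEq ?_)
  filter_upwards [lt_mem_nhds (show (-1 : ℝ) < 0 by norm_num)] with t ht
  rw [← hL.homog x hx v (1 + t) (by linarith), add_smul, one_smul]

theorem momentum_smul (hx : x ∈ U) (hv : v ≠ 0) {c : ℝ} (hc : 0 < c) :
    momentum L (x, c • v) = c • momentum L (x, v) := by
  have h1 : HasFDerivAt (fun v => L x (c • v)) (c • momentum L (x, c • v)) v := by
    refine ((hL.hasFDerivAt_fibre hx (smul_ne_zero hc.ne' hv)).comp v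
      ((hasFDerivAt_id v).const_smul c)).congr_fderiv ?_
    ext w; simp
  have h2 : HasFDerivAt (fun v => L x (c • v)) (c ^ 2 • momentum L (x, v)) v := by
    simp_rw [fun v => hL.homog x hx v c hc]
    exact (hL.hasFDerivAt_fibre hx hv).const_mul _
  have h3 := h1.unique h2
  rw [pow_two, mul_smul] at h3
  exact smul_right_injective _ hc.ne' h3

theorem force_smul (hx : x ∈ U) (hv : v ≠ 0) {c : ℝ} (hc : 0 < c) :
    force L (x, c • v) = c ^ 2 • force L (x, v) := by
  refine (hL.hasFDerivAt_base hx (smul_ne_zero hc.ne' hv)).unique ?_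
  refine ((hL.hasFDerivAt_base hx hv).const_mul (c ^ 2)).congr_of_eventuallyEq ?_
  filter_upwards [hL.isOpen.mem_nhds hx] with y hy using hL.homog y hy v c hc

theorem fibreHessian_smul (hx : x ∈ U) (hv : v ≠ 0) {c : ℝ} (hc : 0 < c) :
    fibreHessian L (x, c • v) = fibreHessian L (x, v) := by
  have h1 : HasFDerivAt (fun v => momentum L (x, c • v)) (c • fibreHessian L (x, c • v)) v := by
    refine ((hL.hasFDerivAt_momentum_fibre hx (smul_ne_zero hc.ne' hv)).comp v
      ((hasFDerivAt_id v).const_smul c)).congr_fderiv ?_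
    ext w; simp
  have h2 : HasFDerivAt (fun v => momentum L (x, c • v)) (c • fibreHessian L (x, v)) v := by
    refine ((hL.hasFDerivAt_momentum_fibre hx hv).const_smul c).congr_of_eventuallyEq ?_
    filter_upwards [isOpen_compl_singleton.mem_nhds hv] with u hu using hL.momentum_smul hx hu hc
  exact smul_right_injective _ hc.ne' (h1.unique h2)

theorem fibreHessian_pos (hx : x ∈ U) (hv : v ≠ 0) (hw : w ≠ 0) :
    0 < fibreHessian L (x, v) w w := by
  have h := hL.convex x hx v w hv hw
  rw [iteratedDeriv_succ, iteratedDeriv_one] at h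
  have h1 : deriv (fun t : ℝ => L x (v + t • w)) =ᶠ[𝓝 0]
      fun t : ℝ => momentum L (x, v + t • w) w := by
    have : ∀ᶠ t : ℝ in 𝓝 0, v + t • w ≠ 0 := by
      have hc : ContinuousAt (fun t : ℝ => v + t • w) 0 := by fun_prop
      exact hc.eventually_ne (by simpa using hv)
    filter_upwards [this] with t ht using (hL.hasDerivAt_line hx ht).deriv
  rw [h1.deriv_eq, (hL.hasDerivAt_momentum_line hx (by simpa using hv)).deriv] at h
  simpa using h

variable [FiniteDimensional ℝ E]

theorem exists_equiv_fibreHessian (hx : x ∈ U) (hv : v ≠ 0) :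
    ∃ e : E ≃L[ℝ] (E →L[ℝ] ℝ), (e : E →L[ℝ] E →L[ℝ] ℝ) = fibreHessian L (x, v) := by
  have hinj : LinearMap.ker (fibreHessian L (x, v) : E →ₗ[ℝ] E →L[ℝ] ℝ) = ⊥ := by
    refine LinearMap.ker_eq_bot'.2 fun w hw => ?_
    by_contra hne
    have h1 : fibreHessian L (x, v) w = 0 := hw
    have h2 := hL.fibreHessian_pos hx hv hne
    rw [h1] at h2
    simp at h2
  have hfin : Module.finrank ℝ E = Module.finrank ℝ (E →L[ℝ] ℝ) := by
    rw [← LinearEquiv.finrank_eq (LinearMap.toContinuousLinearMap (𝕜 := ℝ) (E := E) (F' := ℝ))]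
    exact Subspace.dual_finrank_eq.symm
  refine ⟨(LinearEquiv.ofInjectiveOfFinrankEq (fibreHessian L (x, v) : E →ₗ[ℝ] E →L[ℝ] ℝ)
    (LinearMap.ker_eq_bot.1 hinj) hfin).toContinuousLinearEquiv, ?_⟩
  ext a b
  rfl

theorem contDiffAt_spray (hx : x ∈ U) (hv : v ≠ 0) : ContDiffAt ℝ ∞ (spray L) (x, v) := by
  obtain ⟨e, he⟩ := hL.exists_equiv_fibreHessian hx hv
  have h1 : ContDiffAt ℝ ∞ (fun z => (fibreHessian L z).inverse) (x, v) := by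
    have h2 : ContDiffAt ℝ ∞ ContinuousLinearMap.inverse (fibreHessian L (x, v)) := by
      rw [← he]
      exact contDiffAt_map_inverse e
    exact h2.comp (x, v) (hL.contDiffAt_fibreHessian hx hv)
  refine h1.clm_apply ((hL.contDiffAt_force hx hv).sub ?_)
  exact ((hL.contDiffAt_momentum hx hv).fderiv_right (by norm_cast)).clm_apply
    (contDiffAt_snd.prodMk contDiffAt_const)

/-- The Euler-Lagrange equation `d/dt (∂L/∂v) = ∂L/∂x`, in terms of `spray`. -/
theorem fderiv_momentum_spray (hx : x ∈ U) (hv : v ≠ 0) :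
    fderiv ℝ (momentum L) (x, v) (v, spray L (x, v)) = force L (x, v) := by
  obtain ⟨e, he⟩ := hL.exists_equiv_fibreHessian hx hv
  have h1 : fderiv ℝ (momentum L) (x, v) (0, spray L (x, v)) =
      fibreHessian L (x, v) (spray L (x, v)) := by simp [fibreHessian]
  have h2 : fibreHessian L (x, v) (spray L (x, v)) =
      force L (x, v) - fderiv ℝ (momentum L) (x, v) (v, 0) := by
    rw [spray, ← he, ContinuousLinearMap.inverse_equiv]
    exact e.apply_symm_apply _
  have h3 : ((v, spray L (x, v)) : E × E) = (v, 0) + (0, spray L (x, v)) := by simp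
  rw [h3, map_add, h1, h2]
  abel

/-- Locally uniform positivity of a Finsler metric. -/
theorem exists_le_sq (hx : x ∈ U) : ∃ m > 0, ∀ᶠ y in 𝓝 x, ∀ v, m * ‖v‖ ^ 2 ≤ L y v := by
  obtain ⟨m, hm, h⟩ := exists_pos_le_of_isCompact (isCompact_sphere (0 : E) 1)
    (f := Function.uncurry L) (p := x)
    (fun k hk => (hL.contDiffAt hx (Metric.ne_of_mem_sphere hk one_ne_zero)).continuousAt)
    (fun k hk => hL.pos x hx k (Metric.ne_of_mem_sphere hk one_ne_zero))
  refine ⟨m, hm, ?_⟩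
  filter_upwards [h, hL.isOpen.mem_nhds hx] with y hy hyU v
  rcases eq_or_ne v 0 with rfl | hv
  · simp [hL.apply_zero hyU]
  · have hn : 0 < ‖v‖ := norm_pos_iff.2 hv
    have h1 := hy (‖v‖⁻¹ • v) (by simp [norm_smul, hn.ne'])
    have h2 := hL.homog y hyU (‖v‖⁻¹ • v) ‖v‖ hn
    rw [smul_inv_smul₀ hn.ne'] at h2
    rw [h2, mul_comm]
    exact mul_le_mul_of_nonneg_left h1 (by positivity)

/-- Locally uniform strong convexity of `L` on the fibres. Where the segment from `v` to `w` passes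
through `0`, where `L` is not twice differentiable, the bound comes from homogeneity. -/
theorem exists_strong_convexity (hx : x ∈ U) : ∃ c > 0, ∀ᶠ y in 𝓝 x, ∀ v w, v ≠ 0 →
    L y v + momentum L (y, v) (w - v) + c * ‖w - v‖ ^ 2 ≤ L y w := by
  obtain ⟨m, hm, h⟩ := hL.exists_le_sq hx
  obtain ⟨c, hc, h'⟩ := exists_pos_le_of_isCompact
    ((isCompact_sphere (0 : E) 1).prod (isCompact_sphere (0 : E) 1))
    (f := fun z : E × E × E => fibreHessian L (z.1, z.2.1) z.2.2 z.2.2) (p := x)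
    (fun k hk => by
      have h0 := (hL.contDiffAt_fibreHessian hx
        (Metric.ne_of_mem_sphere hk.1 one_ne_zero)).continuousAt
      have h1 : ContinuousAt (fun z : E × E × E => fibreHessian L (z.1, z.2.1)) (x, k) :=
        ContinuousAt.comp (f := fun z : E × E × E => (z.1, z.2.1)) (x := (x, k)) h0 (by fun_prop)
      have h2 : ContinuousAt (fun z : E × E × E => z.2.2) (x, k) := by fun_prop
      exact (h1.clm_apply h2).clm_apply h2)
    (fun k hk => hL.fibreHessian_pos hx (Metric.ne_of_mem_sphere hk.1 one_ne_zero)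
      (Metric.ne_of_mem_sphere hk.2 one_ne_zero))
  refine ⟨min (c / 2) m, by positivity, ?_⟩
  filter_upwards [h, h', hL.isOpen.mem_nhds hx] with y hy hy' hyU v w hv
  have hess (u a : E) (hu : u ≠ 0) : c * ‖a‖ ^ 2 ≤ fibreHessian L (y, u) a a := by
    rcases eq_or_ne a 0 with rfl | ha
    · simp
    have hn : 0 < ‖u‖ := norm_pos_iff.2 hu
    have hna : 0 < ‖a‖ := norm_pos_iff.2 ha
    have h1 := hy' (‖u‖⁻¹ • u, ‖a‖⁻¹ • a) ⟨by simp [norm_smul, hn.ne'], by simp [norm_smul, hna.ne']⟩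
    simp only [hL.fibreHessian_smul hyU hu (inv_pos.2 hn), map_smul, smul_apply,
      smul_eq_mul] at h1
    rw [← mul_assoc, ← mul_inv, ← div_eq_inv_mul, le_div_iff₀ (by positivity)] at h1
    linarith
  by_cases hseg : ∀ t ∈ Icc (0 : ℝ) 1, v + t • (w - v) ≠ 0
  · have h1 := add_half_le_of_le_deriv2 (m := c * ‖w - v‖ ^ 2)
      (fun t ht => hL.hasDerivAt_line hyU (hseg t ht))
      (fun t ht => hL.hasDerivAt_momentum_line hyU (hseg t ht))
      (fun t ht => hess _ _ (hseg t ht))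
    simp only [zero_smul, add_zero, one_smul, add_sub_cancel] at h1
    have : min (c / 2) m * ‖w - v‖ ^ 2 ≤ c / 2 * ‖w - v‖ ^ 2 := by gcongr; exact min_le_left _ _
    linarith
  · push Not at hseg
    obtain ⟨t, ht, h0⟩ := hseg
    have ht0 : t ≠ 0 := by
      rintro rfl
      exact hv (by simpa using h0)
    have htp : 0 < t := lt_of_le_of_ne ht.1 ht0.symm
    -- here `w - v = -t⁻¹ v` with `t⁻¹ ≥ 1`
    have hwv : w - v = -(t⁻¹ • v) := by
      have h2 : t • (w - v) = -v := by rwa [add_comm, ← eq_neg_iff_add_eq_zero] at h0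
      rw [← smul_neg, ← h2, inv_smul_smul₀ ht0]
    have hw : w = -((t⁻¹ - 1) • v) := by
      have : w = v + (w - v) := by abel
      rw [this, hwv]; module
    have hs : 1 ≤ t⁻¹ := (one_le_inv₀ htp).2 ht.2
    have h3 := hy w
    have h4 := hy v
    rw [hwv, map_neg, map_smul, hL.momentum_apply_self hyU hv, norm_neg, norm_smul,
      Real.norm_of_nonneg (by linarith), smul_eq_mul]
    rw [show ‖w‖ = (t⁻¹ - 1) * ‖v‖ by
      rw [hw, norm_neg, norm_smul, Real.norm_of_nonneg (by linarith)]] at h3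
    have h5 : min (c / 2) m * (t⁻¹ * ‖v‖) ^ 2 ≤ m * (t⁻¹ * ‖v‖) ^ 2 := by
      gcongr; exact min_le_right _ _
    have h6 := mul_le_mul_of_nonneg_left h4 (show 0 ≤ 2 * t⁻¹ - 1 by linarith)
    nlinarith

end IsFinslerLagrangian
end Lagrangian

/-! ### Short geodesics are minimizing -/

section Minimality

variable {E : Type*} [NormedAddCommGroup E] [NormedSpace ℝ E]

/-- The Cauchy-Schwarz inequality for `h = √s · (h / √s)`. -/
theorem sq_integral_le_mul_integral_sq_div {h s : ℝ → ℝ} {δ : ℝ} (hδ : 0 < δ)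
    (hh : ContinuousOn h (Icc 0 1)) (hs : ContinuousOn s (Icc 0 1))
    (hs0 : ∀ t ∈ Icc (0 : ℝ) 1, 0 < s t) (hsδ : ∫ t in (0 : ℝ)..1, s t = δ) :
    (∫ t in (0 : ℝ)..1, h t) ^ 2 ≤ δ * ∫ t in (0 : ℝ)..1, h t ^ 2 / s t := by
  set a := ∫ t in (0 : ℝ)..1, h t
  have hI {f : ℝ → ℝ} (hf : ContinuousOn f (Icc 0 1)) :
      IntervalIntegrable f MeasureTheory.volume 0 1 :=
    hf.intervalIntegrable_of_Icc zero_le_one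
  have h1 : ContinuousOn (fun t => h t ^ 2 / s t) (Icc 0 1) :=
    (hh.pow 2).div hs fun t ht => (hs0 t ht).ne'
  have h2 : 0 ≤ ∫ t in (0 : ℝ)..1, (h t ^ 2 / s t - 2 * (a / δ) * h t + (a / δ) ^ 2 * s t) := by
    refine intervalIntegral.integral_nonneg zero_le_one fun t ht => ?_
    have h3 := hs0 t ht
    have : h t ^ 2 / s t - 2 * (a / δ) * h t + (a / δ) ^ 2 * s t =
        (h t - (a / δ) * s t) ^ 2 / s t := by
      field_simp; ring
    rw [this]; positivity
  rw [intervalIntegral.integral_add ((hI h1).sub ((hI hh).const_mul _)) ((hI hs).const_mul _),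
    intervalIntegral.integral_sub (hI h1) ((hI hh).const_mul _),
    intervalIntegral.integral_const_mul, intervalIntegral.integral_const_mul, hsδ] at h2
  have h3 : δ * ((∫ t in (0 : ℝ)..1, h t ^ 2 / s t) - 2 * (a / δ) * a + (a / δ) ^ 2 * δ) =
      δ * (∫ t in (0 : ℝ)..1, h t ^ 2 / s t) - a ^ 2 := by
    field_simp; ring
  have h4 := mul_nonneg hδ.le h2
  rw [h3] at h4
  linarith

namespace IsFinslerLagrangian

variable {U : Set E} {L : E → E → ℝ} (hL : IsFinslerLagrangian U L) {p e : E}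

include hL

theorem continuousAt (hp : p ∈ U) (v : E) : ContinuousAt (Function.uncurry L) (p, v) :=
  hL.continuousOn.continuousAt ((hL.isOpen.prod isOpen_univ).mem_nhds ⟨hp, trivial⟩)

variable [FiniteDimensional ℝ E]

theorem hasDerivAt_momentum {x v : ℝ → E} {t : ℝ} (hx : x t ∈ U) (hv : v t ≠ 0)
    (h1 : HasDerivAt x (v t) t) (h2 : HasDerivAt v (spray L (x t, v t)) t) :
    HasDerivAt (fun t => momentum L (x t, v t)) (force L (x t, v t)) t := by
  have h := HasFDerivAt.comp_hasDerivAt (f := fun t => (x t, v t)) t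
    (hL.hasFDerivAt_momentum hx hv) (h1.prodMk h2)
  rwa [hL.fderiv_momentum_spray hx hv] at h

/-- Conservation of energy. -/
theorem hasDerivAt_energy {x v : ℝ → E} {t : ℝ} (hx : x t ∈ U) (hv : v t ≠ 0)
    (h1 : HasDerivAt x (v t) t) (h2 : HasDerivAt v (spray L (x t, v t)) t) :
    HasDerivAt (fun t => L (x t) (v t)) 0 t := by
  have h3 : HasDerivAt (fun t => L (x t) (v t))
      (force L (x t, v t) (v t) + momentum L (x t, v t) (spray L (x t, v t))) t := by
    have h := HasFDerivAt.comp_hasDerivAt (f := fun t => (x t, v t)) t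
      (hL.hasFDerivAt hx hv) (h1.prodMk h2)
    refine h.congr_deriv ?_
    simp only [force, momentum, ContinuousLinearMap.comp_apply, ContinuousLinearMap.inl_apply,
      ContinuousLinearMap.inr_apply, ← map_add, Prod.mk_add_mk, add_zero, zero_add]
  have h4 := (hL.hasDerivAt_momentum hx hv h1 h2).clm_apply h2
  -- `d/dt (p v) = d/dt (2 L)` by Euler's identity
  have h5 : HasDerivAt (fun t => 2 * L (x t) (v t))
      (force L (x t, v t) (v t) + momentum L (x t, v t) (spray L (x t, v t))) t := by
    refine h4.congr_of_eventuallyEq ?_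
    filter_upwards [h1.continuousAt.eventually (hL.isOpen.mem_nhds hx),
      h2.continuousAt.eventually_ne hv] with s hs hs'
    exact (hL.momentum_apply_self hs hs').symm
  have h6 := h5.unique (h3.const_mul 2)
  refine h3.congr_deriv ?_
  linarith

theorem energy_eq {x v : ℝ → E} {δ : ℝ}
    (h : ∀ t ∈ Icc 0 δ, x t ∈ U ∧ v t ≠ 0 ∧ HasDerivAt x (v t) t ∧
      HasDerivAt v (spray L (x t, v t)) t) {t : ℝ} (ht : t ∈ Icc 0 δ) :
    L (x t) (v t) = L (x 0) (v 0) := by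
  have hd (t) (ht : t ∈ Icc 0 δ) : HasDerivAt (fun t => L (x t) (v t)) 0 t := by
    obtain ⟨a, b, c, d⟩ := h t ht
    exact hL.hasDerivAt_energy a b c d
  exact constant_of_has_deriv_right_zero
    (fun t ht => (hd t ht).continuousAt.continuousWithinAt)
    (fun t ht => (hd t (Ico_subset_Icc_self ht)).hasDerivWithinAt) t ht

/-- The Weierstrass excess of the Lagrangian is bounded below by a positive multiple of the square
of the difference of the velocities, up to an error that is quadratic in the distance of the
base points. -/
theorem exists_excess_lower_bound (hp : p ∈ U) (he : e ≠ 0) :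
    ∃ c > 0, ∃ C > 0, ∃ ρ > 0, Metric.closedBall p ρ ⊆ U ∧
      ∀ x ∈ Metric.closedBall p ρ, ∀ y ∈ Metric.closedBall p ρ, ∀ v ∈ Metric.closedBall e ρ,
        ∀ w, v ≠ 0 ∧ L x v + force L (x, v) (y - x) + momentum L (x, v) (w - v) +
          c * ‖w - v‖ ^ 2 - C * ‖y - x‖ ^ 2 ≤ L y w := by
  obtain ⟨c, hc, hconv⟩ := hL.exists_strong_convexity hp
  obtain ⟨K, s, hs, hK⟩ := ((hL.contDiffAt_momentum hp he).of_le
    (by norm_cast) : ContDiffAt ℝ 1 _ _).exists_lipschitzOnWith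
  obtain ⟨K', s', hs', hK'⟩ := ((hL.contDiffAt_force hp he).of_le
    (by norm_cast) : ContDiffAt ℝ 1 _ _).exists_lipschitzOnWith
  obtain ⟨r₁, hr₁, h₁⟩ := Metric.eventually_nhds_iff_ball.1
    (hconv.and (hL.isOpen.eventually_mem hp))
  obtain ⟨r₂, hr₂, h₂⟩ := Metric.mem_nhds_iff.1 (inter_mem hs hs')
  set ρ := min (min (r₁ / 2) (r₂ / 2)) (‖e‖ / 2) with hρ
  have hne : 0 < ‖e‖ := norm_pos_iff.2 he
  have hρ0 : 0 < ρ := by positivity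
  have hρ1 : ρ < r₁ := by
    have : ρ ≤ r₁ / 2 := (min_le_left _ _).trans (min_le_left _ _)
    linarith
  have hρ2 : ρ < r₂ := by
    have : ρ ≤ r₂ / 2 := (min_le_left _ _).trans (min_le_right _ _)
    linarith
  have hρ3 : ρ < ‖e‖ := by
    have : ρ ≤ ‖e‖ / 2 := min_le_right _ _
    linarith
  have hb1 {x : E} (hx : x ∈ Metric.closedBall p ρ) : x ∈ Metric.ball p r₁ :=
    Metric.closedBall_subset_ball hρ1 hx
  have hb2 {x v : E} (hx : x ∈ Metric.closedBall p ρ) (hv : v ∈ Metric.closedBall e ρ) :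
      (x, v) ∈ s ∩ s' := by
    refine h₂ ?_
    rw [← ball_prod_same]
    exact ⟨Metric.closedBall_subset_ball hρ2 hx, Metric.closedBall_subset_ball hρ2 hv⟩
  refine ⟨c / 2, by positivity, K' + (K : ℝ) ^ 2 / (2 * c) + 1, by positivity, ρ, hρ0,
    fun x hx => (h₁ x (hb1 hx)).2, ?_⟩
  intro x hx y hy v hv w
  have hv0 : v ≠ 0 := by
    rintro rfl
    rw [Metric.mem_closedBall, dist_zero_left] at hv
    linarith
  refine ⟨hv0, ?_⟩
  have hA := (h₁ y (hb1 hy)).1 v w hv0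
  have hB : ‖L y v - L x v - force L (x, v) (y - x)‖ ≤ K' * ‖y - x‖ * ‖y - x‖ := by
    refine Convex.norm_image_sub_le_of_norm_hasFDerivWithin_le' (s := segment ℝ x y)
      (f := fun z => L z v) (f' := fun z => force L (z, v)) ?_ ?_ (convex_segment x y)
      (left_mem_segment ℝ x y) (right_mem_segment ℝ x y)
    · intro z hz
      have hz' := (convex_closedBall p ρ).segment_subset hx hy hz
      exact (hL.hasFDerivAt_base (h₁ z (hb1 hz')).2 hv0).hasFDerivWithinAt
    · intro z hz
      have hz' := (convex_closedBall p ρ).segment_subset hx hy hz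
      have h3 := hK'.dist_le_mul _ (hb2 hz' hv).2 _ (hb2 hx hv).2
      rw [dist_eq_norm, Prod.dist_eq, dist_self, max_eq_left dist_nonneg, dist_eq_norm] at h3
      refine h3.trans (mul_le_mul_of_nonneg_left ?_ K'.2)
      obtain ⟨a, b, ha, hb, hab, rfl⟩ := hz
      have : a • x + b • y - x = b • (y - x) := by
        rw [show a = 1 - b by linarith]; module
      rw [this, norm_smul, Real.norm_of_nonneg hb]
      exact mul_le_of_le_one_left (norm_nonneg _) (by linarith)
  have hC : ‖momentum L (y, v) (w - v) - momentum L (x, v) (w - v)‖ ≤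
      K * ‖y - x‖ * ‖w - v‖ := by
    have h3 := hK.dist_le_mul _ (hb2 hy hv).1 _ (hb2 hx hv).1
    rw [dist_eq_norm, Prod.dist_eq, dist_self, max_eq_left dist_nonneg, dist_eq_norm] at h3
    exact (ContinuousLinearMap.le_opNorm (momentum L (y, v) - momentum L (x, v)) (w - v)).trans
      (mul_le_mul_of_nonneg_right h3 (norm_nonneg _))
  rw [Real.norm_eq_abs] at hB hC
  have hB' := (abs_le.1 hB).1
  have hC' := (abs_le.1 hC).1
  have hD : K * ‖y - x‖ * ‖w - v‖ ≤ c / 2 * ‖w - v‖ ^ 2 + K ^ 2 / (2 * c) * ‖y - x‖ ^ 2 := by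
    have h4 : 0 ≤ (c * ‖w - v‖ - K * ‖y - x‖) ^ 2 / (2 * c) := by positivity
    have h5 : (c * ‖w - v‖ - K * ‖y - x‖) ^ 2 / (2 * c) =
      c / 2 * ‖w - v‖ ^ 2 + K ^ 2 / (2 * c) * ‖y - x‖ ^ 2 - K * ‖y - x‖ * ‖w - v‖ := by
      field_simp; ring
    linarith
  nlinarith [sq_nonneg ‖y - x‖]

/-- Short geodesics are not longer than any curve with the same end points in a small ball: the
excess bound is integrated along the geodesic, reparametrized to match the speed of the
competitor. -/
theorem exists_length_minimizing (hp : p ∈ U) (he : e ≠ 0) :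
    ∃ ρ > 0, Metric.closedBall p ρ ⊆ U ∧ ∀ (δ : ℝ) (x v : ℝ → E), 0 < δ → δ < ρ →
      (∀ t ∈ Icc 0 δ, HasDerivAt x (v t) t ∧ HasDerivAt v (spray L (x t, v t)) t ∧
        x t ∈ Metric.closedBall p ρ ∧ v t ∈ Metric.closedBall e ρ) →
      ∀ (σ σ' : ℝ → E), ContinuousOn σ' (Icc 0 1) →
        (∀ t ∈ Icc (0 : ℝ) 1, HasDerivWithinAt σ (σ' t) (Icc 0 1) t ∧
          σ t ∈ Metric.closedBall p ρ) →
        σ 0 = x 0 → σ 1 = x δ →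
        δ * √(2 * L (x 0) (v 0)) ≤ ∫ t in (0 : ℝ)..1, √(2 * L (σ t) (σ' t)) := by
  obtain ⟨c, hc, C, hC, ρ, hρ, hρU, hex⟩ := hL.exists_excess_lower_bound hp he
  refine ⟨min ρ (√(c / C)), by positivity,
    (Metric.closedBall_subset_closedBall (min_le_left _ _)).trans hρU, ?_⟩
  intro δ x v hδ hδρ hxv σ σ' hσ' hσ hσ0 hσ1
  have hmono (q : E) : Metric.closedBall q (min ρ (√(c / C))) ⊆ Metric.closedBall q ρ :=
    Metric.closedBall_subset_closedBall (min_le_left _ _)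
  have hCδ : C * δ ^ 2 ≤ c := by
    have h1 : δ ^ 2 ≤ √(c / C) ^ 2 := by
      gcongr; exact hδρ.le.trans (min_le_right _ _)
    rw [Real.sq_sqrt (by positivity), le_div_iff₀ hC] at h1
    linarith
  have hgeo (t) (ht : t ∈ Icc 0 δ) : x t ∈ U ∧ v t ≠ 0 ∧ HasDerivAt x (v t) t ∧
      HasDerivAt v (spray L (x t, v t)) t := by
    obtain ⟨a, b, c, d⟩ := hxv t ht
    exact ⟨hρU (hmono _ c), (hex p (Metric.mem_closedBall_self hρ.le) p
      (Metric.mem_closedBall_self hρ.le) _ (hmono _ d) 0).1, a, b⟩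
  have henergy (t) (ht : t ∈ Icc 0 δ) : L (x t) (v t) = L (x 0) (v 0) := hL.energy_eq hgeo ht
  set ℓ := L (x 0) (v 0) with hℓ
  have hℓ0 : 0 ≤ ℓ := hL.nonneg (hgeo 0 ⟨le_rfl, hδ.le⟩).1 _
  have hσc : ContinuousOn σ (Icc 0 1) := fun t ht => (hσ t ht).1.continuousWithinAt
  set f : ℝ → ℝ := fun t => √(2 * L (σ t) (σ' t)) with hf
  have hfc : ContinuousOn f (Icc 0 1) := by
    refine ContinuousOn.sqrt (continuousOn_const.mul ?_)
    exact hL.continuousOn.comp (hσc.prodMk hσ') fun t ht => ⟨hρU (hmono _ (hσ t ht).2), trivial⟩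
  have hf0 (t) : 0 ≤ f t := Real.sqrt_nonneg _
  set Λ := ∫ t in (0 : ℝ)..1, f t with hΛ
  have hΛ0 : 0 ≤ Λ := intervalIntegral.integral_nonneg zero_le_one fun t _ => hf0 t
  -- a continuous extension of the speed of the competitor
  set F : ℝ → ℝ := IccExtend zero_le_one ((Icc (0 : ℝ) 1).domRestrict f) with hF
  have hFc : Continuous F := (continuousOn_iff_continuous_domRestrict.1 hfc).Icc_extend'
  have hFf (t) (ht : t ∈ Icc (0 : ℝ) 1) : F t = f t := IccExtend_of_mem _ _ ht
  have hF0 (t) : 0 ≤ F t := hf0 _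
  have hFΛ : ∫ t in (0 : ℝ)..1, F t = Λ := by
    refine intervalIntegral.integral_congr fun t ht => ?_
    rw [uIcc_of_le zero_le_one] at ht
    exact hFf t ht
  have hI {g : ℝ → ℝ} (hg : ContinuousOn g (Icc 0 1)) :
      IntervalIntegrable g MeasureTheory.volume 0 1 :=
    hg.intervalIntegrable_of_Icc zero_le_one
  have key : ∀ ε > 0, 2 * ℓ * δ ^ 2 ≤ Λ * (Λ + ε) := by
    intro ε hε
    have hΛε : 0 < Λ + ε := by linarith
    -- the reparametrization `S : [0, 1] → [0, δ]` has speed `s` proportional to the speed of the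
    -- competitor; `ε` keeps `s` positive where the competitor stops
    set a : ℝ := δ / (Λ + ε) with ha
    have ha0 : 0 < a := by positivity
    set S : ℝ → ℝ := fun t => a * ∫ τ in (0 : ℝ)..t, (F τ + ε) with hS
    set s : ℝ → ℝ := fun t => a * (F t + ε) with hs
    have hsc : Continuous s := by fun_prop
    have hs0 (t) : 0 < s t := mul_pos ha0 (by linarith [hF0 t])
    have hSs (t) : HasDerivAt S (s t) t := by
      have h1 : Continuous fun τ => F τ + ε := by fun_prop
      exact ((h1.integral_hasStrictDerivAt 0 t).hasDerivAt).const_mul a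
    have hSc : Continuous S := continuous_iff_continuousAt.2 fun t => (hSs t).continuousAt
    have hS0 : S 0 = 0 := by simp [hS]
    have hS1 : S 1 = δ := by
      simp only [hS]
      rw [intervalIntegral.integral_add (hFc.intervalIntegrable _ _) (by simp), hFΛ]
      simp only [intervalIntegral.integral_const, sub_zero, one_smul, ha]
      field_simp
    have hSmono : Monotone S := monotone_of_deriv_nonneg (fun t => (hSs t).differentiableAt)
      fun t => by rw [(hSs t).deriv]; exact (hs0 t).le
    have hSI {t : ℝ} (ht : t ∈ Icc (0 : ℝ) 1) : S t ∈ Icc 0 δ :=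
      ⟨hS0 ▸ hSmono ht.1, hS1 ▸ hSmono ht.2⟩
    have hsI : ∫ t in (0 : ℝ)..1, s t = δ := by
      rw [intervalIntegral.integral_eq_sub_of_hasDerivAt (fun t _ => hSs t)
        (hsc.intervalIntegrable _ _), hS0, hS1, sub_zero]
    have hxc : ContinuousOn (fun t => x (S t)) (Icc 0 1) := fun t ht =>
      (ContinuousAt.comp (hgeo _ (hSI ht)).2.2.1.continuousAt
        hSc.continuousAt).continuousWithinAt
    have hvc : ContinuousOn (fun t => v (S t)) (Icc 0 1) := fun t ht =>
      (ContinuousAt.comp (hgeo _ (hSI ht)).2.2.2.continuousAt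
        hSc.continuousAt).continuousWithinAt
    -- the difference of the two curves and its velocity
    set g : ℝ → E := fun t => σ t - x (S t) with hg
    set h : ℝ → E := fun t => σ' t - s t • v (S t) with hh
    have hgc : ContinuousOn g (Icc 0 1) := hσc.sub hxc
    have hhc : ContinuousOn h (Icc 0 1) := hσ'.sub (hsc.continuousOn.smul hvc)
    have hxS {t : ℝ} (ht : t ∈ Icc (0 : ℝ) 1) :
        HasDerivAt (fun t => x (S t)) (s t • v (S t)) t :=
      (hgeo _ (hSI ht)).2.2.1.scomp t (hSs t)
    have hσd {t : ℝ} (ht : t ∈ Ioo (0 : ℝ) 1) : HasDerivAt σ (σ' t) t :=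
      (hσ t (Ioo_subset_Icc_self ht)).1.hasDerivAt (Icc_mem_nhds ht.1 ht.2)
    have hgd {t : ℝ} (ht : t ∈ Ioo (0 : ℝ) 1) : HasDerivAt g (h t) t :=
      (hσd ht).sub (hxS (Ioo_subset_Icc_self ht))
    have hg0 : g 0 = 0 := by simp [hg, hS0, hσ0]
    have hg1 : g 1 = 0 := by simp [hg, hS1, hσ1]
    set D := ∫ t in (0 : ℝ)..1, ‖h t‖ ^ 2 / s t with hD
    have hDc : ContinuousOn (fun t => ‖h t‖ ^ 2 / s t) (Icc 0 1) :=
      (hhc.norm.pow 2).div hsc.continuousOn fun t _ => (hs0 t).ne'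
    have hgD {t : ℝ} (ht : t ∈ Icc (0 : ℝ) 1) : ‖g t‖ ^ 2 ≤ δ * D := by
      have h1 : Icc 0 t ⊆ Icc (0 : ℝ) 1 := Icc_subset_Icc_right ht.2
      have h2 : ∫ τ in (0 : ℝ)..t, h τ = g t := by
        rw [intervalIntegral.integral_eq_sub_of_hasDerivAt_of_le ht.1 (hgc.mono h1)
          (fun τ hτ => hgd ⟨hτ.1, hτ.2.trans_le ht.2⟩)
          ((hhc.mono h1).intervalIntegrable_of_Icc ht.1), hg0, sub_zero]
      have h3 : ‖g t‖ ≤ ∫ τ in (0 : ℝ)..1, ‖h τ‖ := by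
        rw [← h2]
        refine (intervalIntegral.norm_integral_le_integral_norm ht.1).trans ?_
        exact intervalIntegral.integral_mono_interval le_rfl ht.1 ht.2
          (Eventually.of_forall fun _ => norm_nonneg _) (hI hhc.norm)
      calc ‖g t‖ ^ 2 ≤ (∫ τ in (0 : ℝ)..1, ‖h τ‖) ^ 2 := by gcongr
        _ ≤ _ := sq_integral_le_mul_integral_sq_div hδ hhc.norm hsc.continuousOn
          (fun t _ => hs0 t) hsI
    have hD0 : 0 ≤ D := intervalIntegral.integral_nonneg zero_le_one fun t _ => by
      have := hs0 t
      positivity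
    -- the first order terms of the excess bound are the derivative of `P (g)`, by the
    -- Euler-Lagrange equation
    set P : ℝ → E →L[ℝ] ℝ := fun t => momentum L (x (S t), v (S t)) with hP
    set Q : ℝ → E →L[ℝ] ℝ := fun t => force L (x (S t), v (S t)) with hQ
    have hPd {t : ℝ} (ht : t ∈ Icc (0 : ℝ) 1) : HasDerivAt P (s t • Q t) t := by
      obtain ⟨h1, h2, h3, h4⟩ := hgeo _ (hSI ht)
      exact (hL.hasDerivAt_momentum h1 h2 h3 h4).scomp t (hSs t)
    have hPc : ContinuousOn P (Icc 0 1) := fun t ht =>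
      (hPd ht).continuousAt.continuousWithinAt
    have hQc : ContinuousOn Q (Icc 0 1) := fun t ht =>
      ContinuousAt.comp_continuousWithinAt (f := fun t => (x (S t), v (S t)))
        (hL.contDiffAt_force (hgeo _ (hSI ht)).1 (hgeo _ (hSI ht)).2.1).continuousAt
        ((hxc t ht).prodMk (hvc t ht))
    set Z' : ℝ → ℝ := fun t => s t * Q t (g t) + P t (h t) with hZ'
    have hZ'c : ContinuousOn Z' (Icc 0 1) :=
      (hsc.continuousOn.mul (hQc.clm_apply hgc)).add (hPc.clm_apply hhc)
    have hZ : ∫ t in (0 : ℝ)..1, Z' t = 0 := by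
      rw [intervalIntegral.integral_eq_sub_of_hasDerivAt_of_le zero_le_one
        (hPc.clm_apply hgc) (fun t ht => ?_) (hI hZ'c), hg0, hg1, map_zero, map_zero, sub_zero]
      exact (hPd (Ioo_subset_Icc_self ht)).clm_apply (hgd ht)
    have hpt : ∀ t ∈ Icc (0 : ℝ) 1, ℓ * s t + Z' t + c * (‖h t‖ ^ 2 / s t) -
        C * (δ * D) * s t ≤ f t * ((Λ + ε) / (2 * δ)) := by
      intro t ht
      have hst := hs0 t
      have h1 := (hex _ (hmono _ (hxv _ (hSI ht)).2.2.1) _ (hmono _ (hσ t ht).2) _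
        (hmono _ (hxv _ (hSI ht)).2.2.2) ((s t)⁻¹ • σ' t)).2
      rw [henergy _ (hSI ht), hL.homog _ (hρU (hmono _ (hσ t ht).2)) _ _ (inv_pos.2 hst)] at h1
      have h2 : (s t)⁻¹ • σ' t - v (S t) = (s t)⁻¹ • h t := by
        simp only [hh, smul_sub, inv_smul_smul₀ hst.ne']
      rw [h2, map_smul, norm_smul, norm_inv, Real.norm_of_nonneg hst.le] at h1
      have h3 := mul_le_mul_of_nonneg_left h1 hst.le
      have h4 : 2 * L (σ t) (σ' t) = f t ^ 2 := by
        rw [hf, Real.sq_sqrt]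
        have := hL.nonneg (hρU (hmono _ (hσ t ht).2)) (σ' t)
        positivity
      have h5 : s t * ((s t)⁻¹ ^ 2 * L (σ t) (σ' t)) ≤ f t * ((Λ + ε) / (2 * δ)) := by
        have h6 : s t * ((s t)⁻¹ ^ 2 * L (σ t) (σ' t)) = f t ^ 2 / (2 * s t) := by
          rw [← h4]; field_simp
        rw [h6, div_le_iff₀ (by positivity)]
        simp only [hs, ha, hFf t ht]
        have : f t * ((Λ + ε) / (2 * δ)) * (2 * (δ / (Λ + ε) * (f t + ε))) =
          f t * (f t + ε) := by field_simp
        rw [this]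
        nlinarith [hf0 t]
      have h7 : s t * (ℓ + Q t (g t) + (s t)⁻¹ • P t (h t) + c * ((s t)⁻¹ * ‖h t‖) ^ 2 -
          C * ‖g t‖ ^ 2) = ℓ * s t + Z' t + c * (‖h t‖ ^ 2 / s t) - C * ‖g t‖ ^ 2 * s t := by
        simp only [hZ', smul_eq_mul]
        field_simp
        ring
      have h8 := h3.trans h5
      change s t * (ℓ + Q t (g t) + (s t)⁻¹ • P t (h t) + c * ((s t)⁻¹ * ‖h t‖) ^ 2 -
          C * ‖g t‖ ^ 2) ≤ _ at h8
      rw [h7] at h8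
      have h9 : C * ‖g t‖ ^ 2 * s t ≤ C * (δ * D) * s t := by
        gcongr
        exact hgD ht
      linarith
    have hc1 : ContinuousOn (fun t => ℓ * s t) (Icc 0 1) := (hsc.const_mul _).continuousOn
    have hc2 := hDc.const_mul c
    have hc3 : ContinuousOn (fun t => C * (δ * D) * s t) (Icc 0 1) :=
      (hsc.const_mul _).continuousOn
    have hi₃ : IntervalIntegrable (fun t => ℓ * s t + Z' t) MeasureTheory.volume 0 1 :=
      hI (hc1.add hZ'c)
    have hi₄ : IntervalIntegrable (fun t => ℓ * s t + Z' t + c * (‖h t‖ ^ 2 / s t))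
        MeasureTheory.volume 0 1 := hi₃.add (hI hc2)
    have hi₁ : IntervalIntegrable (fun t => ℓ * s t + Z' t + c * (‖h t‖ ^ 2 / s t) -
        C * (δ * D) * s t) MeasureTheory.volume 0 1 := hi₄.sub (hI hc3)
    have hi₂ : IntervalIntegrable (fun t => f t * ((Λ + ε) / (2 * δ))) MeasureTheory.volume 0 1 :=
      hI (hfc.mul continuousOn_const)
    have hsm (b : ℝ) : ∫ t in (0 : ℝ)..1, b * s t = b * δ := by
      rw [← hsI]; exact intervalIntegral.integral_const_mul b s
    have hint := intervalIntegral.integral_mono_on zero_le_one hi₁ hi₂ hpt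
    rw [intervalIntegral.integral_mul_const] at hint
    rw [intervalIntegral.integral_sub hi₄ (hI hc3),
      intervalIntegral.integral_add hi₃ (hI hc2),
      intervalIntegral.integral_add (hI hc1) (hI hZ'c), hZ,
      hsm ℓ, hsm (C * (δ * D)), intervalIntegral.integral_const_mul] at hint
    change ℓ * δ + 0 + c * D - C * (δ * D) * δ ≤ Λ * ((Λ + ε) / (2 * δ)) at hint
    have h1 : C * (δ * D) * δ ≤ c * D := by
      have := mul_le_mul_of_nonneg_right hCδ hD0
      linarith
    have h2 : ℓ * δ ≤ Λ * ((Λ + ε) / (2 * δ)) := by linarith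
    rw [← mul_div_assoc, le_div_iff₀ (by positivity)] at h2
    linarith
  have h1 : 2 * ℓ * δ ^ 2 ≤ Λ * Λ := by
    refine le_of_forall_pos_le_add fun ε hε => ?_
    have h2 := key (ε / (Λ + 1)) (by positivity)
    have h3 : Λ * (ε / (Λ + 1)) ≤ ε := by
      rw [mul_div_assoc', div_le_iff₀ (by positivity)]
      nlinarith
    linarith
  refine abs_le_of_sq_le_sq' ?_ hΛ0 |>.2
  rw [mul_pow, Real.sq_sqrt (by positivity)]
  linarith

end IsFinslerLagrangian
end Minimality

/-! ### Charts of the tangent bundle -/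

section Charts

variable {n : ℕ} [NeZero n] {M : Type*} [TopologicalSpace M]
  [ChartedSpace (EuclideanHalfSpace n) M]

local notation "𝔼" => EuclideanSpace ℝ (Fin n)

/-- The part of the image of the chart at `p₀` that comes from interior points. -/
def chartInterior (p₀ : M) : Set 𝔼 :=
  (extChartAt (𝓡∂ n) p₀).target ∩ interior (range (𝓡∂ n))

theorem chartInterior_subset (p₀ : M) : chartInterior (n := n) p₀ ⊆ (extChartAt (𝓡∂ n) p₀).target :=
  inter_subset_left

theorem isOpen_chartInterior (p₀ : M) : IsOpen (chartInterior (n := n) p₀) := by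
  have h : chartInterior (n := n) p₀ = (𝓡∂ n).symm ⁻¹'
      (chartAt (EuclideanHalfSpace n) p₀).target ∩ interior (range (𝓡∂ n)) := by
    rw [chartInterior, extChartAt_target, inter_assoc,
      inter_eq_right.2 (interior_subset (s := range (𝓡∂ n)))]
  rw [h]
  exact ((chartAt (EuclideanHalfSpace n) p₀).open_target.preimage
    (𝓡∂ n).continuous_symm).inter isOpen_interior

theorem chartAt_symm_mem {p₀ : M} {x : 𝔼} (hx : x ∈ (extChartAt (𝓡∂ n) p₀).target) :
    (extChartAt (𝓡∂ n) p₀).symm x ∈ (chartAt (EuclideanHalfSpace n) p₀).source := by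
  simpa using (extChartAt (𝓡∂ n) p₀).map_target hx

variable [IsManifold (𝓡∂ n) ∞ M]

theorem mem_bundleChart_source {p₀ : M} {z : TM n M} :
    z ∈ (bundleChart p₀).source ↔ z.proj ∈ (chartAt (EuclideanHalfSpace n) p₀).source := by
  simp [bundleChart]

theorem mem_bundleChart_target {p₀ : M} {z : 𝔼 × 𝔼} :
    z ∈ (bundleChart p₀).target ↔ z.1 ∈ (extChartAt (𝓡∂ n) p₀).target := by
  simp only [bundleChart]
  rw [FiberBundle.extChartAt_target]
  constructor
  · exact fun h => h.1.1
  · exact fun h => ⟨⟨h, by simpa using (extChartAt (𝓡∂ n) p₀).map_target h⟩, trivial⟩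

/-- The coordinates of tangent vectors at `q` in the chart at `p₀`. -/
def fibreCoord (p₀ q : M) : TangentSpace (𝓡∂ n) q →L[ℝ] 𝔼 :=
  (trivializationAt 𝔼 (TangentSpace (𝓡∂ n) : M → Type _) p₀).continuousLinearMapAt ℝ q

/-- The tangent vectors at `q` with given coordinates in the chart at `p₀`. -/
def fibreCoordSymm (p₀ q : M) : 𝔼 →L[ℝ] TangentSpace (𝓡∂ n) q :=
  (trivializationAt 𝔼 (TangentSpace (𝓡∂ n) : M → Type _) p₀).symmL ℝ q

theorem mem_baseSet {p₀ q : M} (hq : q ∈ (chartAt (EuclideanHalfSpace n) p₀).source) :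
    q ∈ (trivializationAt 𝔼 (TangentSpace (𝓡∂ n) : M → Type _) p₀).baseSet := by
  simpa using hq

theorem fibreCoord_symm {p₀ q : M} (hq : q ∈ (chartAt (EuclideanHalfSpace n) p₀).source) (v : 𝔼) :
    fibreCoord p₀ q (fibreCoordSymm p₀ q v) = v :=
  Bundle.Trivialization.continuousLinearMapAt_symmL _ (mem_baseSet hq) v

theorem fibreCoordSymm_apply {p₀ q : M} (hq : q ∈ (chartAt (EuclideanHalfSpace n) p₀).source)
    (v : TangentSpace (𝓡∂ n) q) : fibreCoordSymm p₀ q (fibreCoord p₀ q v) = v :=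
  Bundle.Trivialization.symmL_continuousLinearMapAt _ (mem_baseSet hq) v

theorem bundleChart_apply {p₀ : M} {z : TM n M}
    (hz : z.proj ∈ (chartAt (EuclideanHalfSpace n) p₀).source) :
    bundleChart p₀ z = (extChartAt (𝓡∂ n) p₀ z.proj, fibreCoord p₀ z.proj z.2) := by
  have h := Bundle.Trivialization.continuousLinearMapAt_apply_of_mem (R := ℝ)
    (trivializationAt 𝔼 (TangentSpace (𝓡∂ n) : M → Type _) p₀) (mem_baseSet hz) z.2
  simp only [bundleChart, fibreCoord]
  rw [FiberBundle.extChartAt, h]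
  rfl

theorem bundleChart_symm_apply {p₀ : M} {x v : 𝔼} (hx : x ∈ (extChartAt (𝓡∂ n) p₀).target) :
    (bundleChart p₀).symm (x, v) = ⟨(extChartAt (𝓡∂ n) p₀).symm x,
      fibreCoordSymm p₀ ((extChartAt (𝓡∂ n) p₀).symm x) v⟩ := by
  have h1 : (extChartAt (𝓡∂ n) p₀).symm x ∈ (chartAt (EuclideanHalfSpace n) p₀).source := by
    simpa using (extChartAt (𝓡∂ n) p₀).map_target hx
  refine (bundleChart p₀).injOn ?_ ?_ ?_
  · exact (bundleChart p₀).map_target (mem_bundleChart_target.2 hx)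
  · exact mem_bundleChart_source.2 h1
  · rw [(bundleChart p₀).right_inv (mem_bundleChart_target.2 hx), bundleChart_apply h1,
      fibreCoord_symm h1, (extChartAt (𝓡∂ n) p₀).right_inv hx]

theorem contMDiffOn_bundleChart_symm (p₀ : M) :
    ContMDiffOn 𝓘(ℝ, 𝔼 × 𝔼) (𝓡∂ n).tangent ∞ (bundleChart (n := n) p₀).symm
      (bundleChart (n := n) p₀).target :=
  contMDiffOn_extChartAt_symm _


theorem extChartAt_mem_chartInterior {p₀ q : M} (hq : q ∈ (𝓡∂ n).interior M)
    (hq' : q ∈ (chartAt (EuclideanHalfSpace n) p₀).source) :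
    extChartAt (𝓡∂ n) p₀ q ∈ chartInterior p₀ :=
  ⟨(extChartAt (𝓡∂ n) p₀).map_source (by simpa using hq'),
    interior_mono (extChartAt_target_subset_range p₀)
      ((ModelWithCorners.isInteriorPoint_iff_of_mem_atlas (n := ∞) (by simp)
        (chart_mem_atlas _ p₀) hq').1 hq)⟩

theorem lagrangian_eq (φ : FinslerMetric n M) (p₀ : M) {x : 𝔼}
    (hx : x ∈ (extChartAt (𝓡∂ n) p₀).target) (v : 𝔼) :
    lagrangian φ p₀ x v = φ.toFun ⟨(extChartAt (𝓡∂ n) p₀).symm x,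
      fibreCoordSymm p₀ ((extChartAt (𝓡∂ n) p₀).symm x) v⟩ ^ 2 / 2 := by
  rw [lagrangian, bundleChart_symm_apply hx]

theorem fibreCoordSymm_ne_zero {p₀ q : M}
    (hq : q ∈ (chartAt (EuclideanHalfSpace n) p₀).source) {v : 𝔼} (hv : v ≠ 0) :
    fibreCoordSymm p₀ q v ≠ 0 := by
  intro h
  apply hv
  rw [← fibreCoord_symm hq v, h, map_zero]

theorem isFinslerLagrangian (φ : FinslerMetric n M) (p₀ : M) :
    IsFinslerLagrangian (chartInterior p₀) (lagrangian φ p₀) where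
  isOpen := isOpen_chartInterior p₀
  contDiffOn := by
    have h1 : ContMDiffOn 𝓘(ℝ, 𝔼 × 𝔼) 𝓘(ℝ, ℝ) ∞ (fun z => φ.toFun ((bundleChart p₀).symm z))
        (chartInterior p₀ ×ˢ {0}ᶜ) := by
      refine φ.smooth'.comp ((contMDiffOn_bundleChart_symm p₀).mono ?_) ?_
      · exact fun z hz => mem_bundleChart_target.2 (chartInterior_subset _ hz.1)
      · rintro ⟨x, v⟩ ⟨hx, hv⟩
        have hx' := chartInterior_subset _ hx
        change ((bundleChart p₀).symm (x, v)).2 ≠ 0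
        rw [bundleChart_symm_apply hx']
        exact fibreCoordSymm_ne_zero (chartAt_symm_mem hx') hv
    exact (h1.contDiffOn.pow 2).div_const 2
  continuousOn := by
    have h1 : ContinuousOn (fun z => φ.toFun ((bundleChart p₀).symm z))
        (chartInterior p₀ ×ˢ univ) :=
      φ.continuous_toFun.comp_continuousOn ((contMDiffOn_bundleChart_symm p₀).continuousOn.mono
        fun z hz => mem_bundleChart_target.2 (chartInterior_subset _ hz.1))
    exact (h1.pow 2).div_const 2
  homog x hx v c hc := by
    have hx' := chartInterior_subset _ hx
    rw [lagrangian_eq φ p₀ hx', lagrangian_eq φ p₀ hx', map_smul, φ.homog' _ _ _ hc]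
    ring
  pos x hx v hv := by
    have hx' := chartInterior_subset _ hx
    rw [lagrangian_eq φ p₀ hx']
    have := φ.pos' _ _ (fibreCoordSymm_ne_zero (chartAt_symm_mem hx') hv)
    positivity
  convex x hx v w hv hw := by
    have hx' := chartInterior_subset _ hx
    have hs := chartAt_symm_mem hx'
    have h := φ.convex' _ _ _ (fibreCoordSymm_ne_zero hs hv) (fibreCoordSymm_ne_zero hs hw)
    simp_rw [lagrangian_eq φ p₀ hx', map_add, map_smul]
    have h2 (g : ℝ → ℝ) : deriv (fun t => g t / 2) = fun t => deriv g t / 2 :=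
      funext fun t => deriv_div_const 2
    rw [iteratedDeriv_succ, iteratedDeriv_one] at h ⊢
    rw [h2, h2]
    exact half_pos h

end Charts

/-! ### Minimizing geodesics to a point of the interior -/

section Directions

variable {n : ℕ} [NeZero n] {M : Type*} [TopologicalSpace M]
  [ChartedSpace (EuclideanHalfSpace n) M] [IsManifold (𝓡∂ n) ∞ M]

local notation "𝔼" => EuclideanSpace ℝ (Fin n)

theorem FinslerMetric.nonneg (φ : FinslerMetric n M) (z : TM n M) : 0 ≤ φ.toFun z := by
  obtain ⟨p, v⟩ := z
  rcases eq_or_ne v 0 with rfl | hv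
  · have := φ.homog' p 0 2 two_pos
    rw [smul_zero] at this
    exact ge_of_eq (by linarith)
  · exact (φ.pos' p v hv).le

theorem FinslerMetric.eq_sqrt_lagrangian (φ : FinslerMetric n M) (p₀ : M) {z : TM n M}
    (hz : z.proj ∈ (chartAt (EuclideanHalfSpace n) p₀).source) :
    φ.toFun z = √(2 * lagrangian φ p₀ (bundleChart p₀ z).1 (bundleChart p₀ z).2) := by
  rw [lagrangian, Prod.mk.eta, (bundleChart p₀).left_inv (mem_bundleChart_source.2 hz),
    mul_div_cancel₀ _ two_ne_zero, Real.sqrt_sq (φ.nonneg z)]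

theorem dLdv_eq_momentum (φ : FinslerMetric n M) (p₀ : M) {z : TM n M}
    (hz : (bundleChart p₀ z).1 ∈ chartInterior p₀) (hz' : (bundleChart p₀ z).2 ≠ 0) :
    dLdv φ p₀ z = momentum (lagrangian φ p₀) (bundleChart p₀ z) :=
  ((isFinslerLagrangian φ p₀).hasFDerivAt_fibre hz hz').fderiv

theorem dLdx_eq_force (φ : FinslerMetric n M) (p₀ : M) {z : TM n M}
    (hz : (bundleChart p₀ z).1 ∈ chartInterior p₀) (hz' : (bundleChart p₀ z).2 ≠ 0) :
    dLdx φ p₀ z = force (lagrangian φ p₀) (bundleChart p₀ z) := by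
  rw [dLdx, fderivWithin_of_mem_nhds (mem_interior_iff_mem_nhds.1 hz.2)]
  exact ((isFinslerLagrangian φ p₀).hasFDerivAt_base hz hz').fderiv

/-- The curve of tangent vectors with coordinates `(x, v)` in the chart at `p₀`. -/
def liftCurve (p₀ : M) (x v : ℝ → 𝔼) (t : ℝ) : TM n M :=
  ⟨(extChartAt (𝓡∂ n) p₀).symm (x t),
    fibreCoordSymm p₀ ((extChartAt (𝓡∂ n) p₀).symm (x t)) (v t)⟩

theorem bundleChart_liftCurve {p₀ : M} {x v : ℝ → 𝔼} {t : ℝ}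
    (hx : x t ∈ (extChartAt (𝓡∂ n) p₀).target) :
    bundleChart p₀ (liftCurve p₀ x v t) = (x t, v t) := by
  rw [liftCurve, ← bundleChart_symm_apply hx,
    (bundleChart p₀).right_inv (mem_bundleChart_target.2 hx)]

/-- Solutions of the Euler-Lagrange equation in a chart are geodesics. -/
theorem isGeodesicFlowLine_liftCurve (φ : FinslerMetric n M) (p₀ : M) {x v a : ℝ → 𝔼} {ℓ : ℝ}
    (hℓ : 0 < ℓ) (hx : ∀ t ∈ Icc 0 ℓ, x t ∈ chartInterior (n := n) p₀)
    (hv : ∀ t ∈ Icc 0 ℓ, v t ≠ 0)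
    (hxv : ∀ t ∈ Icc 0 ℓ, HasDerivAt x (v t) t) (hva : ∀ t ∈ Icc 0 ℓ, HasDerivAt v (a t) t)
    (ha : ContinuousOn a (Icc 0 ℓ))
    (hEL : ∀ t ∈ Icc 0 ℓ, HasDerivWithinAt (fun t => momentum (lagrangian φ p₀) (x t, v t))
      (force (lagrangian φ p₀) (x t, v t)) (Icc 0 ℓ) t) :
    IsGeodesicFlowLine φ (liftCurve p₀ x v) (Icc 0 ℓ) := by
  have htgt (t) (ht : t ∈ Icc 0 ℓ) := chartInterior_subset _ (hx t ht)
  have hud := uniqueDiffOn_Icc hℓ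
  refine ⟨?_, fun t ht => ⟨?_, p₀, chartAt_symm_mem (htgt t ht), ?_⟩⟩
  · have hdx : ContDiffOn ℝ 1 x (Icc 0 ℓ) := by
      rw [contDiffOn_one_iff_derivWithin hud]
      refine ⟨fun t ht => (hxv t ht).differentiableAt.differentiableWithinAt, ?_⟩
      exact ContinuousOn.congr (fun t ht => (hva t ht).continuousAt.continuousWithinAt)
        fun t ht => (hxv t ht).hasDerivWithinAt.derivWithin (hud t ht)
    have hdv : ContDiffOn ℝ 1 v (Icc 0 ℓ) := by
      rw [contDiffOn_one_iff_derivWithin hud]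
      refine ⟨fun t ht => (hva t ht).differentiableAt.differentiableWithinAt, ?_⟩
      exact ha.congr fun t ht => (hva t ht).hasDerivWithinAt.derivWithin (hud t ht)
    have h1 : ContMDiffOn 𝓘(ℝ, ℝ) 𝓘(ℝ, 𝔼 × 𝔼) 1 (fun t => (x t, v t)) (Icc 0 ℓ) :=
      (hdx.prodMk hdv).contMDiffOn
    have h2 := ((contMDiffOn_bundleChart_symm (n := n) p₀).of_le
      (by norm_cast) : ContMDiffOn _ _ 1 _ _).comp h1
      fun t ht => mem_bundleChart_target.2 (htgt t ht)
    exact h2.congr fun t ht => (bundleChart_symm_apply (htgt t ht)).symm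
  · have h1 : HasMFDerivWithinAt 𝓘(ℝ, ℝ) 𝓘(ℝ, 𝔼) x (Icc 0 ℓ) t
        (ContinuousLinearMap.toSpanSingleton ℝ (v t)) :=
      (hxv t ht).hasDerivWithinAt.hasFDerivWithinAt.hasMFDerivWithinAt
    have hs := chartAt_symm_mem (htgt t ht)
    have h2 : HasMFDerivWithinAt 𝓘(ℝ, 𝔼) (𝓡∂ n) (extChartAt (𝓡∂ n) p₀).symm (range (𝓡∂ n)) (x t)
        (fibreCoordSymm p₀ ((extChartAt (𝓡∂ n) p₀).symm (x t))) := by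
      have h3 := (mdifferentiableWithinAt_extChartAt_symm (I := 𝓡∂ n) (htgt t ht)).hasMFDerivWithinAt
      have h4 := TangentBundle.symmL_trivializationAt (I := 𝓡∂ n) hs
      rw [(extChartAt (𝓡∂ n) p₀).right_inv (htgt t ht)] at h4
      rw [← h4] at h3
      exact h3
    have h3 := h2.comp t h1 fun s hs => extChartAt_target_subset_range p₀ (htgt s hs)
    refine h3.congr_mfderiv ?_
    refine ContinuousLinearMap.ext_ring ?_
    change fibreCoordSymm _ _ ((1 : ℝ) • v t) = (1 : ℝ) • fibreCoordSymm _ _ (v t)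
    rw [map_smul]
  · have hb (s) (hs : s ∈ Icc 0 ℓ) : bundleChart p₀ (liftCurve p₀ x v s) = (x s, v s) :=
      bundleChart_liftCurve (htgt s hs)
    have hm (s) (hs : s ∈ Icc 0 ℓ) :
        dLdv φ p₀ (liftCurve p₀ x v s) = momentum (lagrangian φ p₀) (x s, v s) := by
      rw [dLdv_eq_momentum φ p₀ (by rw [hb s hs]; exact hx s hs) (by rw [hb s hs]; exact hv s hs),
        hb s hs]
    rw [dLdx_eq_force φ p₀ (by rw [hb t ht]; exact hx t ht) (by rw [hb t ht]; exact hv t ht),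
      hb t ht]
    exact (hEL t ht).congr hm (hm t ht)

/-- The velocity of a curve defined on `[0, 1]`. -/
def velocity (σ : ℝ → M) (t : ℝ) : TM n M :=
  ⟨σ t, mfderivWithin 𝓘(ℝ, ℝ) (𝓡∂ n) σ (Icc 0 1) t (1 : ℝ)⟩

theorem continuousOn_velocity {σ : ℝ → M} (hσ : ContMDiffOn 𝓘(ℝ, ℝ) (𝓡∂ n) 1 σ (Icc 0 1)) :
    ContinuousOn (velocity (n := n) σ) (Icc 0 1) := by
  have h1 := hσ.continuousOn_tangentMapWithin le_rfl
    (uniqueDiffOn_Icc zero_lt_one).uniqueMDiffOn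
  have h2 : Continuous (fun t : ℝ => (⟨t, (1 : ℝ)⟩ : TangentBundle 𝓘(ℝ, ℝ) ℝ)) := by
    rw [← (tangentBundleModelSpaceHomeomorph 𝓘(ℝ, ℝ)).comp_continuous_iff]
    exact continuous_id.prodMk continuous_const
  exact h1.comp h2.continuousOn fun t ht => ht

/-- The velocity computed in a chart. -/
theorem hasDerivWithinAt_extChartAt_comp {σ : ℝ → M}
    (hσ : ContMDiffOn 𝓘(ℝ, ℝ) (𝓡∂ n) 1 σ (Icc 0 1)) (p₀ : M) {t : ℝ} (ht : t ∈ Icc (0 : ℝ) 1)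
    (hs : σ t ∈ (chartAt (EuclideanHalfSpace n) p₀).source) :
    HasDerivWithinAt (fun t => extChartAt (𝓡∂ n) p₀ (σ t)) (bundleChart p₀ (velocity σ t)).2
      (Icc 0 1) t := by
  have h1 := ((hσ t ht).mdifferentiableWithinAt one_ne_zero).hasMFDerivWithinAt
  have h2 := (mdifferentiableAt_extChartAt (I := 𝓡∂ n) hs).hasMFDerivAt
  rw [← TangentBundle.continuousLinearMapAt_trivializationAt (I := 𝓡∂ n) hs] at h2
  have h3 := (h2.comp_hasMFDerivWithinAt t h1)
  rw [bundleChart_apply (z := velocity σ t) hs, hasDerivWithinAt_iff_hasFDerivWithinAt]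
  have h4 : HasMFDerivWithinAt 𝓘(ℝ, ℝ) 𝓘(ℝ, 𝔼) (fun t => extChartAt (𝓡∂ n) p₀ (σ t)) (Icc 0 1) t
      (ContinuousLinearMap.toSpanSingleton ℝ (fibreCoord p₀ (σ t) (velocity σ t).2 : 𝔼)) := by
    refine h3.congr_mfderiv ?_
    refine ContinuousLinearMap.ext_ring ?_
    exact (one_smul ℝ _).symm
  exact hasMFDerivWithinAt_iff_hasFDerivWithinAt.1 h4

theorem length_eq (φ : FinslerMetric n M) (σ : ℝ → M) :
    length φ σ = ∫ t in (0 : ℝ)..1, φ.toFun (velocity σ t) := rfl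

theorem continuousOn_bundleChart_velocity {σ : ℝ → M}
    (hσ : ContMDiffOn 𝓘(ℝ, ℝ) (𝓡∂ n) 1 σ (Icc 0 1)) (p₀ : M) {s : Set ℝ} (hs : s ⊆ Icc 0 1)
    (h : ∀ t ∈ s, σ t ∈ (chartAt (EuclideanHalfSpace n) p₀).source) :
    ContinuousOn (fun t => bundleChart (n := n) p₀ (velocity σ t)) s :=
  (continuousOn_extChartAt (I := (𝓡∂ n).tangent) (⟨p₀, 0⟩ : TM n M)).comp
    ((continuousOn_velocity hσ).mono hs) fun t ht => mem_bundleChart_source.2 (h t ht)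

/-- A curve that starts in a ball of a chart stays in the ball or is at least as long as a
multiple of the distance to the boundary sphere. -/
theorem mem_closedBall_or_le_length [T2Space M] (φ : FinslerMetric n M) {p₀ : M} {p : 𝔼} {r m : ℝ}
    (hr : Metric.closedBall p r ⊆ chartInterior (n := n) p₀)
    (hm : ∀ y ∈ Metric.closedBall p r, ∀ v, m * ‖v‖ ^ 2 ≤ lagrangian φ p₀ y v) {σ : ℝ → M}
    (hσ : ContMDiffOn 𝓘(ℝ, ℝ) (𝓡∂ n) 1 σ (Icc 0 1))
    (h0 : σ 0 ∈ (chartAt (EuclideanHalfSpace n) p₀).source)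
    (h0' : extChartAt (𝓡∂ n) p₀ (σ 0) ∈ Metric.ball p r) :
    (∀ t ∈ Icc (0 : ℝ) 1, σ t ∈ (chartAt (EuclideanHalfSpace n) p₀).source ∧
      extChartAt (𝓡∂ n) p₀ (σ t) ∈ Metric.closedBall p r) ∨
    √(2 * m) * (r - dist (extChartAt (𝓡∂ n) p₀ (σ 0)) p) ≤ length φ σ := by
  set V : Set M := (chartAt (EuclideanHalfSpace n) p₀).source ∩
    extChartAt (𝓡∂ n) p₀ ⁻¹' Metric.ball p r with hV
  have hVo : IsOpen V := isOpen_extChartAt_preimage p₀ Metric.isOpen_ball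
  by_cases hall : ∀ t ∈ Icc (0 : ℝ) 1, σ t ∈ V
  · exact Or.inl fun t ht => ⟨(hall t ht).1, Metric.ball_subset_closedBall (hall t ht).2⟩
  right
  -- the first exit time from the open ball
  obtain ⟨T, ⟨hT, hTV⟩, hTmin⟩ : ∃ T, IsLeast {t ∈ Icc (0 : ℝ) 1 | σ t ∉ V} T := by
    push Not at hall
    refine IsCompact.exists_isLeast ?_ hall
    refine isCompact_Icc.of_isClosed_subset ?_ fun t ht => ht.1
    exact hσ.continuousOn.preimage_isClosed_of_isClosed isClosed_Icc hVo.isClosed_compl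
  have hlt (t) (ht : t ∈ Ico 0 T) : σ t ∈ V := by
    by_contra hcon
    exact absurd (hTmin ⟨⟨ht.1, ht.2.le.trans hT.2⟩, hcon⟩) (not_le.2 ht.2)
  have hT0 : 0 < T := lt_of_le_of_ne hT.1 fun h => hTV (h ▸ ⟨h0, h0'⟩)
  set K : Set M := (extChartAt (𝓡∂ n) p₀).symm '' Metric.closedBall p r with hK
  have hKc : IsCompact K := (isCompact_closedBall p r).image_of_continuousOn
    ((continuousOn_extChartAt_symm p₀).mono (hr.trans (chartInterior_subset p₀)))
  have hKmem (q) (hq : q ∈ K) : q ∈ (chartAt (EuclideanHalfSpace n) p₀).source ∧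
      extChartAt (𝓡∂ n) p₀ q ∈ Metric.closedBall p r := by
    obtain ⟨y, hy, rfl⟩ := hq
    have hy' := chartInterior_subset _ (hr hy)
    refine ⟨chartAt_symm_mem hy', ?_⟩
    rwa [(extChartAt (𝓡∂ n) p₀).right_inv hy']
  have hTK : σ T ∈ K := by
    have hne : (𝓝[Ico 0 T] T).NeBot := by
      rw [nhdsWithin_Ico_eq_nhdsLT hT0]; infer_instance
    have hsub : Ico 0 T ⊆ Icc (0 : ℝ) 1 := fun t ht => ⟨ht.1, ht.2.le.trans hT.2⟩
    refine hKc.isClosed.mem_of_tendsto ((hσ.continuousOn T hT).mono hsub) ?_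
    filter_upwards [self_mem_nhdsWithin] with t ht
    refine ⟨_, Metric.ball_subset_closedBall (hlt t ht).2, ?_⟩
    exact (extChartAt (𝓡∂ n) p₀).left_inv (by simpa using (hlt t ht).1)
  have hmem (t) (ht : t ∈ Icc 0 T) : σ t ∈ (chartAt (EuclideanHalfSpace n) p₀).source ∧
      extChartAt (𝓡∂ n) p₀ (σ t) ∈ Metric.closedBall p r := by
    rcases eq_or_lt_of_le ht.2 with rfl | h
    · exact hKmem _ hTK
    · exact ⟨(hlt t ⟨ht.1, h⟩).1, Metric.ball_subset_closedBall (hlt t ⟨ht.1, h⟩).2⟩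
  have hrT : r ≤ dist (extChartAt (𝓡∂ n) p₀ (σ T)) p := by
    by_contra hcon
    exact hTV ⟨(hmem T ⟨hT0.le, le_rfl⟩).1, not_le.1 hcon⟩
  have hsub : Icc 0 T ⊆ Icc (0 : ℝ) 1 := Icc_subset_Icc_right hT.2
  set w : ℝ → 𝔼 := fun t => (bundleChart p₀ (velocity σ t)).2 with hw
  have hwc : ContinuousOn w (Icc 0 T) :=
    (continuousOn_bundleChart_velocity hσ p₀ hsub fun t ht => (hmem t ht).1).snd
  have hφc : ContinuousOn (fun t => φ.toFun (velocity σ t)) (Icc 0 1) :=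
    φ.continuous_toFun.comp_continuousOn (continuousOn_velocity hσ)
  have hd (t) (ht : t ∈ Icc 0 T) :=
    hasDerivWithinAt_extChartAt_comp hσ p₀ (hsub ht) (hmem t ht).1
  have h1 : ∫ t in (0 : ℝ)..T, w t =
      extChartAt (𝓡∂ n) p₀ (σ T) - extChartAt (𝓡∂ n) p₀ (σ 0) :=
    intervalIntegral.integral_eq_sub_of_hasDerivAt_of_le hT0.le
      (fun t ht => (hd t ht).continuousWithinAt.mono hsub)
      (fun t ht => (hd t (Ioo_subset_Icc_self ht)).hasDerivAt
        (Icc_mem_nhds ht.1 (ht.2.trans_le hT.2)))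
      (hwc.intervalIntegrable_of_Icc hT0.le)
  have h2 : r - dist (extChartAt (𝓡∂ n) p₀ (σ 0)) p ≤ ∫ t in (0 : ℝ)..T, ‖w t‖ := by
    refine le_trans ?_ (intervalIntegral.norm_integral_le_integral_norm hT0.le)
    rw [h1, ← dist_eq_norm]
    linarith [dist_triangle (extChartAt (𝓡∂ n) p₀ (σ T)) (extChartAt (𝓡∂ n) p₀ (σ 0)) p]
  have h3 : ∀ t ∈ Icc 0 T, √(2 * m) * ‖w t‖ ≤ φ.toFun (velocity σ t) := by
    intro t ht
    rw [φ.eq_sqrt_lagrangian p₀ (z := velocity σ t) (hmem t ht).1]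
    have h4 := hm _ (hmem t ht).2 (w t)
    have h5 : (bundleChart p₀ (velocity σ t)).1 = extChartAt (𝓡∂ n) p₀ (σ t) := by
      rw [bundleChart_apply (z := velocity σ t) (hmem t ht).1]; rfl
    rw [h5]
    refine Real.le_sqrt_of_sq_le ?_
    rw [mul_pow]
    rcases le_or_gt 0 m with hm0 | hm0
    · rw [Real.sq_sqrt (by positivity)]; linarith
    · rw [Real.sqrt_eq_zero_of_nonpos (by linarith)]
      have := (isFinslerLagrangian φ p₀).nonneg (hr (hmem t ht).2) (w t)
      simpa using this
  have h4 : ∫ t in (0 : ℝ)..T, √(2 * m) * ‖w t‖ ≤ ∫ t in (0 : ℝ)..T, φ.toFun (velocity σ t) :=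
    intervalIntegral.integral_mono_on hT0.le
      ((hwc.norm.const_mul _).intervalIntegrable_of_Icc hT0.le)
      ((hφc.mono hsub).intervalIntegrable_of_Icc hT0.le) h3
  have h5 : ∫ t in (0 : ℝ)..T, φ.toFun (velocity σ t) ≤ length φ σ :=
    intervalIntegral.integral_mono_interval le_rfl hT0.le hT.2
      (Eventually.of_forall fun t => φ.nonneg _) (hφc.intervalIntegrable_of_Icc zero_le_one)
  rw [intervalIntegral.integral_const_mul] at h4
  have h6 := mul_le_mul_of_nonneg_left h2 (Real.sqrt_nonneg (2 * m))
  linarith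

/-- Points near an interior point `p` are joined to `p` by minimizing geodesics, whose initial
direction is close to the direction of the straight segment in a chart. -/
theorem exists_isDirectionTo [T2Space M] (φ : FinslerMetric n M) {p₀ p : M}
    (hp : p ∈ (𝓡∂ n).interior M) (hp' : p ∈ (chartAt (EuclideanHalfSpace n) p₀).source)
    {e : 𝔼} (he : e ≠ 0) :
    ∃ C > 0, ∀ᶠ z : ℝ × 𝔼 in 𝓝 (0, e), 0 < z.1 →
      ∀ q ∈ (chartAt (EuclideanHalfSpace n) p₀).source,
        extChartAt (𝓡∂ n) p₀ q = extChartAt (𝓡∂ n) p₀ p - z.1 • z.2 →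
        ∃ V : 𝔼, ‖V - z.2‖ ≤ C * z.1 ∧ IsDirectionTo φ q p (fibreCoordSymm p₀ q
          ((√(2 * lagrangian φ p₀ (extChartAt (𝓡∂ n) p₀ q) V))⁻¹ • V)) := by
  have hL := isFinslerLagrangian φ p₀
  set L := lagrangian φ p₀ with hLdef
  set P := extChartAt (𝓡∂ n) p₀ p with hP
  have hPU : P ∈ chartInterior p₀ := extChartAt_mem_chartInterior hp hp'
  obtain ⟨ρ, hρ, hρU, hmin⟩ := hL.exists_length_minimizing hPU he
  obtain ⟨m, hm, hmL⟩ := hL.exists_le_sq hPU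
  obtain ⟨ρ', hρ', hρ'm⟩ := Metric.eventually_nhds_iff_ball.1 hmL
  set r := min ρ (ρ' / 2) with hr
  have hr0 : 0 < r := by positivity
  have hrm (y) (hy : y ∈ Metric.closedBall P r) (v) : m * ‖v‖ ^ 2 ≤ L y v := by
    refine hρ'm y (Metric.closedBall_subset_ball ?_ hy) v
    have : r ≤ ρ' / 2 := min_le_right _ _
    linarith
  have hrρ : Metric.closedBall P r ⊆ Metric.closedBall P ρ :=
    Metric.closedBall_subset_closedBall (min_le_left _ _)
  obtain ⟨C, hC, δ₀, hδ₀, hbvp⟩ := exists_boundaryValueSolution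
    ((hL.contDiffAt_spray hPU he).of_le (by norm_cast) : ContDiffAt ℝ 1 _ _)
  set κ₀ := √(2 * L P e) + 1 with hκ₀
  have hne : 0 < ‖e‖ := norm_pos_iff.2 he
  obtain ⟨η₀, hη₀, hηκ⟩ : ∃ η > 0, ∀ x v, dist x P < η → dist v e < η → √(2 * L x v) < κ₀ := by
    have h1 : ContinuousAt (fun z : 𝔼 × 𝔼 => √(2 * Function.uncurry L z)) (P, e) :=
      ((hL.continuousAt hPU e).const_mul 2).sqrt
    have h2 : ∀ᶠ z in 𝓝 (P, e), √(2 * Function.uncurry L z) < κ₀ :=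
      h1.eventually (gt_mem_nhds (lt_add_one _))
    obtain ⟨η, hη, h3⟩ := Metric.eventually_nhds_iff_ball.1 h2
    refine ⟨η, hη, fun x v hx hv => h3 (x, v) ?_⟩
    rw [← ball_prod_same]
    exact ⟨hx, hv⟩
  set η := min η₀ ‖e‖ with hηdef
  have hη : 0 < η := lt_min hη₀ hne
  refine ⟨C, hC, ?_⟩
  have ev (f : ℝ × 𝔼 → ℝ) (hf : ContinuousAt f (0, e)) {b : ℝ} (hb : f (0, e) < b) :
      ∀ᶠ z in 𝓝 (0, e), f z < b := hf.eventually (gt_mem_nhds hb)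
  have e1 := ev (fun z => z.1) (by fun_prop) (b := min δ₀ ρ) (by simp [hδ₀, hρ])
  have e2 := ev (fun z => ‖z.2 - e‖) (by fun_prop) (b := δ₀) (by simp [hδ₀])
  have e3 := ev (fun z => C * z.1 + ‖z.2 - e‖) (by fun_prop) (b := min r η) (by simp [hr0, hη])
  have e4 := ev (fun z => z.1 * κ₀ + √(2 * m) * (z.1 * ‖z.2‖)) (by fun_prop) (b := √(2 * m) * r)
    (by simp only [zero_mul, mul_zero, add_zero]; positivity)
  have e5 := ev (fun z => z.1 * ‖z.2‖) (by fun_prop) (b := r) (by simp [hr0])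
  filter_upwards [e1, e2, e3, e4, e5]
  rintro ⟨δ, e'⟩ h1 h2 h3 h4 h5 hδ q hq hqe
  simp only [lt_min_iff] at h1 h2 h3 h4 h5 hδ hqe ⊢
  obtain ⟨x, v, hx0, hx1, hxv⟩ := hbvp δ e' hδ h1.1 h2
  have hCδ : 0 < C * δ := by positivity
  have h0mem : (0 : ℝ) ∈ Icc 0 δ := ⟨le_rfl, hδ.le⟩
  have hxr (t) (ht : t ∈ Icc 0 δ) : dist (x t) P < min r η := by
    rw [dist_eq_norm]
    have := (hxv t ht).2.2.1
    refine lt_min ?_ ?_ <;> linarith [norm_nonneg (e' - e)]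
  have hvr (t) (ht : t ∈ Icc 0 δ) : dist (v t) e < min r η := by
    have h6 := (hxv t ht).2.2.2
    have h7 := dist_triangle (v t) e' e
    rw [dist_eq_norm, dist_eq_norm, dist_eq_norm] at h7
    rw [dist_eq_norm]
    refine lt_min ?_ ?_ <;> linarith
  have hxρ (t) (ht : t ∈ Icc 0 δ) : x t ∈ Metric.closedBall P ρ :=
    hrρ ((hxr t ht).le.trans (min_le_left _ _))
  have hvρ (t) (ht : t ∈ Icc 0 δ) : v t ∈ Metric.closedBall e ρ :=
    (hvr t ht).le.trans ((min_le_left _ _).trans (min_le_left _ _))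
  have hmin' := hmin δ x v hδ h1.2 fun t ht =>
    ⟨(hxv t ht).1, (hxv t ht).2.1, hxρ t ht, hvρ t ht⟩
  have hv0 (t) (ht : t ∈ Icc 0 δ) : v t ≠ 0 := by
    intro h0
    have h6 := hvr t ht
    rw [h0, dist_zero_left] at h6
    exact absurd (h6.trans_le ((min_le_right _ _).trans (min_le_right _ _))) (lt_irrefl _)
  have hqx : extChartAt (𝓡∂ n) p₀ q = x 0 := by rw [hx0, hqe]
  have hgeo (t) (ht : t ∈ Icc 0 δ) : x t ∈ chartInterior p₀ ∧ v t ≠ 0 ∧ HasDerivAt x (v t) t ∧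
      HasDerivAt v (spray L (x t, v t)) t :=
    ⟨hρU (hxρ t ht), hv0 t ht, (hxv t ht).1, (hxv t ht).2.1⟩
  set κ := √(2 * L (x 0) (v 0)) with hκ
  have hL0 := hL.pos _ (hgeo 0 h0mem).1 _ (hv0 0 h0mem)
  have hκ0 : 0 < κ := Real.sqrt_pos.2 (by positivity)
  have hκκ : κ < κ₀ := hηκ _ _ ((hxr 0 h0mem).trans_le ((min_le_right _ _).trans (min_le_left _ _)))
    ((hvr 0 h0mem).trans_le ((min_le_right _ _).trans (min_le_left _ _)))
  -- the speed `κ` is constant; slowing down time by `κ` gives the unit speed geodesic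
  refine ⟨v 0, (hxv 0 h0mem).2.2.2, ?_⟩
  rw [hqx, ← hκ]
  have hdiv {t : ℝ} (ht : t ∈ Icc 0 (δ * κ)) : t / κ ∈ Icc 0 δ :=
    ⟨div_nonneg ht.1 hκ0.le, (div_le_iff₀ hκ0).2 ht.2⟩
  have hdd (t : ℝ) : HasDerivAt (fun t : ℝ => t / κ) κ⁻¹ t := by
    simpa using (hasDerivAt_id t).div_const κ
  have hκi : 0 < κ⁻¹ := inv_pos.2 hκ0
  refine ⟨δ * κ, liftCurve p₀ (fun t => x (t / κ)) (fun t => κ⁻¹ • v (t / κ)), by positivity,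
    ?_, ?_, ?_, ?_, ?_⟩
  · refine isGeodesicFlowLine_liftCurve φ p₀
      (a := fun t => κ⁻¹ • κ⁻¹ • spray L (x (t / κ), v (t / κ))) (by positivity)
      (fun t ht => (hgeo _ (hdiv ht)).1)
      (fun t ht => smul_ne_zero hκi.ne' (hv0 _ (hdiv ht)))
      (fun t ht => (hgeo _ (hdiv ht)).2.2.1.scomp t (hdd t))
      (fun t ht => ((hgeo _ (hdiv ht)).2.2.2.scomp t (hdd t)).const_smul κ⁻¹) ?_ ?_
    · intro t ht
      obtain ⟨a, b, c, d⟩ := hgeo _ (hdiv ht)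
      have h6 : ContinuousAt (fun s => (x (s / κ), v (s / κ))) t :=
        (ContinuousAt.comp (f := fun s => s / κ) c.continuousAt (hdd t).continuousAt).prodMk
          (ContinuousAt.comp (f := fun s => s / κ) d.continuousAt (hdd t).continuousAt)
      have h7 : ContinuousAt (fun s => spray L (x (s / κ), v (s / κ))) t :=
        ContinuousAt.comp (f := fun s => (x (s / κ), v (s / κ)))
          (hL.contDiffAt_spray a b).continuousAt h6
      exact ((h7.const_smul κ⁻¹).const_smul κ⁻¹).continuousWithinAt
    · intro t ht
      have h6 (s) (hs : s ∈ Icc 0 (δ * κ)) : momentum L (x (s / κ), κ⁻¹ • v (s / κ)) =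
          κ⁻¹ • momentum L (x (s / κ), v (s / κ)) :=
        hL.momentum_smul (hgeo _ (hdiv hs)).1 (hv0 _ (hdiv hs)) hκi
      obtain ⟨a, b, c, d⟩ := hgeo _ (hdiv ht)
      have h7 := ((hL.hasDerivAt_momentum a b c d).scomp t (hdd t)).const_smul κ⁻¹
      rw [← hLdef, hL.force_smul a b hκi, pow_two, mul_smul]
      exact h7.hasDerivWithinAt.congr h6 (h6 t ht)
  · intro t ht
    obtain ⟨a, b, c, d⟩ := hgeo _ (hdiv ht)
    have ha := chartInterior_subset _ a
    rw [φ.eq_sqrt_lagrangian p₀ (z := liftCurve p₀ (fun t => x (t / κ)) (fun t => κ⁻¹ • v (t / κ)) t)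
        (chartAt_symm_mem ha),
      bundleChart_liftCurve (x := fun t => x (t / κ)) ha]
    simp only
    rw [← hLdef, hL.homog _ a _ _ hκi, hL.energy_eq hgeo (hdiv ht)]
    have h6 : 2 * (κ⁻¹ ^ 2 * L (x 0) (v 0)) = 1 := by
      have h7 : κ ^ 2 = 2 * L (x 0) (v 0) := Real.sq_sqrt (by positivity)
      rw [mul_left_comm, ← h7]
      field_simp
    rw [h6, Real.sqrt_one]
  · have h6 : (extChartAt (𝓡∂ n) p₀).symm (x 0) = q := by
      rw [← hqx]; exact (extChartAt (𝓡∂ n) p₀).left_inv (by simpa using hq)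
    change (⟨(extChartAt (𝓡∂ n) p₀).symm (x (0 / κ)), fibreCoordSymm p₀
      ((extChartAt (𝓡∂ n) p₀).symm (x (0 / κ))) (κ⁻¹ • v (0 / κ))⟩ : TM n M) = _
    rw [zero_div, h6]
  · simp only [liftCurve, mul_div_cancel_right₀ _ hκ0.ne', hx1, hP]
    exact (extChartAt (𝓡∂ n) p₀).left_inv (by simpa using hp')
  · intro σ hσ hσ0 hσ1
    have hPq : dist (extChartAt (𝓡∂ n) p₀ q) P = δ * ‖e'‖ := by
      rw [hqe, dist_eq_norm, sub_sub_cancel_left, norm_neg, norm_smul, Real.norm_of_nonneg hδ.le]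
    rcases mem_closedBall_or_le_length φ (hrρ.trans hρU) hrm hσ (hσ0 ▸ hq) (by
      rw [hσ0, Metric.mem_ball, hPq]; exact h5) with hin | hlen
    · have h6 := hmin' (fun t => extChartAt (𝓡∂ n) p₀ (σ t))
        (fun t => (bundleChart p₀ (velocity σ t)).2)
        (continuousOn_bundleChart_velocity hσ p₀ subset_rfl fun t ht => (hin t ht).1).snd
        (fun t ht => ⟨hasDerivWithinAt_extChartAt_comp hσ p₀ ht (hin t ht).1,
          hrρ (hin t ht).2⟩) (by simp only [hσ0, hqx]) (by simp only [hσ1, hx1, hP])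
      refine h6.trans (le_of_eq ?_)
      rw [length_eq]
      refine intervalIntegral.integral_congr fun t ht => ?_
      rw [uIcc_of_le zero_le_one] at ht
      rw [φ.eq_sqrt_lagrangian p₀ (z := velocity σ t) (hin t ht).1,
        bundleChart_apply (z := velocity σ t) (hin t ht).1]
      rfl
    · rw [hσ0, hPq] at hlen
      have : δ * κ ≤ δ * κ₀ := by gcongr
      linarith

end Directions

/-! ### Independent linear forms -/

section Spread

variable {E : Type*} [NormedAddCommGroup E] [NormedSpace ℝ E]

/-- A quantitative form of the linear independence of finitely many linear forms. -/
def IsSpread {k : ℕ} (c : ℝ) (w : Fin k → E →L[ℝ] ℝ) : Prop :=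
  ∀ a : Fin k → ℝ, ‖a‖ = 1 → c ≤ ‖∑ i, a i • w i‖

theorem exists_isSpread {k : ℕ} {w : Fin k → E →L[ℝ] ℝ} (hw : LinearIndependent ℝ w) :
    ∃ c > 0, IsSpread c w := by
  have h1 := linearIndependent_iff_injective_fintypeLinearCombination.1 hw
  obtain ⟨K, hK, hKf⟩ :=
    (Fintype.linearCombination ℝ w).exists_antilipschitzWith (LinearMap.ker_eq_bot.2 h1)
  refine ⟨(K : ℝ)⁻¹, by positivity, fun a ha => ?_⟩
  have h2 := hKf.le_mul_dist a 0
  rw [map_zero, dist_zero_right, dist_zero_right, ha, Fintype.linearCombination_apply] at h2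
  rw [inv_le_iff_one_le_mul₀ (by positivity), mul_comm]
  exact h2

theorem IsSpread.linearIndependent {k : ℕ} {c : ℝ} (hc : 0 < c) {w : Fin k → E →L[ℝ] ℝ}
    (hw : IsSpread c w) : LinearIndependent ℝ w := by
  rw [Fintype.linearIndependent_iff]
  intro a ha
  by_contra hne
  have h0 : a ≠ 0 := fun h => hne fun i => congrFun h i
  have h1 := hw (‖a‖⁻¹ • a) (by
    rw [norm_smul, norm_inv, norm_norm, inv_mul_cancel₀ (norm_ne_zero_iff.2 h0)])
  simp only [Pi.smul_apply, smul_eq_mul, mul_smul] at h1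
  rw [← Finset.smul_sum, ha, smul_zero, norm_zero] at h1
  linarith

theorem IsSpread.of_tendsto {k : ℕ} {c : ℝ} {w : ℕ → Fin k → E →L[ℝ] ℝ} {w' : Fin k → E →L[ℝ] ℝ}
    (hw : ∀ i, IsSpread c (w i)) (h : Tendsto w atTop (𝓝 w')) : IsSpread c w' := by
  intro a ha
  refine ge_of_tendsto' (x := atTop) (f := fun i => ‖∑ l, a l • w i l‖) ?_ fun i => hw i a ha
  exact (tendsto_finsetSum _ fun l _ => ((tendsto_pi_nhds.1 h l).const_smul (a l))).norm

end Spread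

/-! ### Balanced split loci -/

section SplitLoci

variable {n : ℕ} [NeZero n] {M : Type*} [TopologicalSpace M]
  [ChartedSpace (EuclideanHalfSpace n) M] [IsManifold (𝓡∂ n) ∞ M]

local notation "𝔼" => EuclideanSpace ℝ (Fin n)

theorem firstCountableTopology_tangentBundle : FirstCountableTopology (TM n M) := by
  have h₁ : FirstCountableTopology (EuclideanHalfSpace n) :=
    inferInstanceAs (FirstCountableTopology {x : 𝔼 // 0 ≤ x 0})
  have h : FirstCountableTopology (ModelProd (EuclideanHalfSpace n) 𝔼) :=
    inferInstanceAs (FirstCountableTopology (EuclideanHalfSpace n × 𝔼))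
  refine ⟨fun z => ?_⟩
  rw [← (chartAt (ModelProd (EuclideanHalfSpace n) 𝔼) z).symm_map_nhds_eq
    (mem_chart_source _ z)]
  infer_instance

theorem tendsto_bundleChart {z : ℕ → TM n M} {z₀ : TM n M} {p₀ : M}
    (h₀ : z₀.proj ∈ (chartAt (EuclideanHalfSpace n) p₀).source) (h : Tendsto z atTop (𝓝 z₀)) :
    Tendsto (fun i => bundleChart p₀ (z i)) atTop (𝓝 (bundleChart p₀ z₀)) :=
  (continuousAt_extChartAt' (I := (𝓡∂ n).tangent) (x := (⟨p₀, 0⟩ : TM n M))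
    (mem_bundleChart_source.2 h₀)).tendsto.comp h

theorem tendsto_of_tendsto_bundleChart {z : ℕ → TM n M} {z₀ : TM n M} {p₀ : M}
    (h₀ : z₀.proj ∈ (chartAt (EuclideanHalfSpace n) p₀).source)
    (hz : ∀ i, (z i).proj ∈ (chartAt (EuclideanHalfSpace n) p₀).source)
    (h : Tendsto (fun i => bundleChart p₀ (z i)) atTop (𝓝 (bundleChart p₀ z₀))) :
    Tendsto z atTop (𝓝 z₀) := by
  have h1 := (continuousAt_extChartAt_symm'' (I := (𝓡∂ n).tangent) (x := (⟨p₀, 0⟩ : TM n M))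
    ((bundleChart p₀).map_source (mem_bundleChart_source.2 h₀))).tendsto.comp h
  have h2 : (extChartAt (𝓡∂ n).tangent (⟨p₀, 0⟩ : TM n M)).symm (bundleChart p₀ z₀) = z₀ :=
    (bundleChart p₀).left_inv (mem_bundleChart_source.2 h₀)
  rw [h2] at h1
  exact h1.congr fun i => (bundleChart p₀).left_inv (mem_bundleChart_source.2 (hz i))

/-- Along a sequence that converges to `p` in the direction `-e` of a chart, the directions of the
minimizing geodesics to `p` converge to a positive multiple of `e`. -/
theorem exists_tendsto_isDirectionTo [T2Space M] (φ : FinslerMetric n M) {p₀ p : M}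
    (hp : p ∈ (𝓡∂ n).interior M) (hp' : p ∈ (chartAt (EuclideanHalfSpace n) p₀).source)
    {e : 𝔼} (he : e ≠ 0) {q : ℕ → M}
    (hq : ∀ i, q i ∈ (chartAt (EuclideanHalfSpace n) p₀).source ∧ q i ≠ p)
    (hlim : Tendsto (fun i => extChartAt (𝓡∂ n) p₀ (q i)) atTop (𝓝 (extChartAt (𝓡∂ n) p₀ p)))
    (hdir : Tendsto (fun i => ‖extChartAt (𝓡∂ n) p₀ p - extChartAt (𝓡∂ n) p₀ (q i)‖⁻¹ •
      (extChartAt (𝓡∂ n) p₀ p - extChartAt (𝓡∂ n) p₀ (q i))) atTop (𝓝 e)) :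
    ∃ c > (0 : ℝ), ∃ (N : ℕ) (u : (i : ℕ) → TangentSpace (𝓡∂ n) (q (i + N))),
      (∀ i, IsDirectionTo φ (q (i + N)) p (u i)) ∧
      Tendsto (fun i => (⟨q (i + N), u i⟩ : TM n M)) atTop
        (𝓝 (⟨p, fibreCoordSymm p₀ p (c • e)⟩ : TM n M)) := by
  have hL := isFinslerLagrangian φ p₀
  set L := lagrangian φ p₀ with hLdef
  set P := extChartAt (𝓡∂ n) p₀ p with hP
  have hPU : P ∈ chartInterior p₀ := extChartAt_mem_chartInterior hp hp'
  set Q : ℕ → 𝔼 := fun i => extChartAt (𝓡∂ n) p₀ (q i) with hQ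
  have hPQ (i) : P - Q i ≠ 0 := by
    rw [sub_ne_zero]
    intro h
    exact (hq i).2 ((extChartAt (𝓡∂ n) p₀).injOn (by simpa using (hq i).1)
      (by simpa using hp') h.symm)
  have hpos (i) : 0 < ‖P - Q i‖ := norm_pos_iff.2 (hPQ i)
  have hδ : Tendsto (fun i => ‖P - Q i‖) atTop (𝓝 0) := by
    simpa using (tendsto_const_nhds (x := P)).sub hlim |>.norm
  obtain ⟨C, hC, hev⟩ := exists_isDirectionTo φ hp hp' he
  obtain ⟨N, hN⟩ := eventually_atTop.1 ((hδ.prodMk_nhds hdir).eventually hev)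
  have hex (i) := hN (i + N) (by omega) (hpos _) (q (i + N)) (hq _).1 (by
    change Q (i + N) = P - ‖P - Q (i + N)‖ • ‖P - Q (i + N)‖⁻¹ • (P - Q (i + N))
    rw [smul_inv_smul₀ (hpos (i + N)).ne', sub_sub_cancel])
  choose V hV hVdir using hex
  have hshift : Tendsto (fun i => i + N) atTop atTop := tendsto_add_atTop_nat N
  have hVlim : Tendsto V atTop (𝓝 e) := by
    have h1 : Tendsto (fun i => V i - ‖P - Q (i + N)‖⁻¹ • (P - Q (i + N))) atTop (𝓝 0) := by
      refine squeeze_zero_norm hV ?_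
      simpa using (hδ.comp hshift).const_mul C
    have h2 := h1.add (hdir.comp hshift)
    rw [zero_add] at h2
    exact h2.congr fun i => sub_add_cancel _ _
  have hLpos : 0 < L P e := hL.pos P hPU e he
  have hκ : Tendsto (fun i => (√(2 * L (Q (i + N)) (V i)))⁻¹) atTop (𝓝 (√(2 * L P e))⁻¹) := by
    refine Tendsto.inv₀ ?_ (Real.sqrt_pos.2 (by positivity)).ne'
    have h1 := (hL.continuousAt hPU e).tendsto.comp ((hlim.comp hshift).prodMk_nhds hVlim)
    exact (h1.const_mul 2).sqrt
  refine ⟨(√(2 * L P e))⁻¹, by positivity, N, _, hVdir, ?_⟩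
  refine tendsto_of_tendsto_bundleChart hp' (fun i => (hq _).1) ?_
  rw [bundleChart_apply (z := (⟨p, _⟩ : TM n M)) hp', fibreCoord_symm hp']
  have h2 : (fun i => bundleChart p₀ (⟨q (i + N), fibreCoordSymm p₀ (q (i + N))
      ((√(2 * L (Q (i + N)) (V i)))⁻¹ • V i)⟩ : TM n M)) =
      fun i => (Q (i + N), (√(2 * L (Q (i + N)) (V i)))⁻¹ • V i) := by
    funext i
    rw [bundleChart_apply (z := (⟨q (i + N), _⟩ : TM n M)) (hq _).1, fibreCoord_symm (hq _).1]
  exact h2 ▸ (hlim.comp hshift).prodMk_nhds (hκ.smul hVlim)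

/-- The balance condition in a chart, for points that converge to `p` in the direction `-e`. The
factor `c` does not depend on the vectors in `R`, so the conclusion can be compared for different
sequences of vectors. -/
theorem IsBalancedAt.isGreatest [T2Space M] {φ : FinslerMetric n M}
    {Γ : (x : M) → TangentSpace (𝓡∂ n) x} {S : Set M} {p₀ p : M} (hS : IsBalancedAt φ Γ S p)
    (hp : p ∈ (𝓡∂ n).interior M) (hp' : p ∈ (chartAt (EuclideanHalfSpace n) p₀).source)
    {e : 𝔼} (he : e ≠ 0) {q : ℕ → M}
    (hq : ∀ i, q i ∈ (chartAt (EuclideanHalfSpace n) p₀).source ∧ q i ≠ p)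
    (hlim : Tendsto (fun i => extChartAt (𝓡∂ n) p₀ (q i)) atTop (𝓝 (extChartAt (𝓡∂ n) p₀ p)))
    (hdir : Tendsto (fun i => ‖extChartAt (𝓡∂ n) p₀ p - extChartAt (𝓡∂ n) p₀ (q i)‖⁻¹ •
      (extChartAt (𝓡∂ n) p₀ p - extChartAt (𝓡∂ n) p₀ (q i))) atTop (𝓝 e)) :
    ∃ c > (0 : ℝ), ∀ (X : (i : ℕ) → TangentSpace (𝓡∂ n) (q i)) (X' : TangentSpace (𝓡∂ n) p),
      (∀ i, X i ∈ R φ Γ S (q i)) → X' ∈ R φ Γ S p →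
      Tendsto (fun i => (⟨q i, X i⟩ : TM n M)) atTop (𝓝 (⟨p, X'⟩ : TM n M)) →
      ∀ w' : TangentSpace (𝓡∂ n) p →L[ℝ] ℝ, IsDualForm φ p X' w' →
        IsGreatest ((fun w : TangentSpace (𝓡∂ n) p →L[ℝ] ℝ => w (fibreCoordSymm p₀ p (c • e))) ''
          Rdual φ Γ S p) (w' (fibreCoordSymm p₀ p (c • e))) := by
  obtain ⟨c, hc, N, u, hu, hulim⟩ := exists_tendsto_isDirectionTo φ hp hp' he hq hlim hdir
  have hshift : Tendsto (fun i => i + N) atTop atTop := tendsto_add_atTop_nat N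
  have hqlim : Tendsto q atTop (𝓝 p) := by
    have h1 := (continuousAt_extChartAt_symm' (I := 𝓡∂ n) (x := p₀)
      (by simpa using hp')).tendsto.comp hlim
    rw [(extChartAt (𝓡∂ n) p₀).left_inv (by simpa using hp')] at h1
    exact h1.congr fun i => (extChartAt (𝓡∂ n) p₀).left_inv (by simpa using (hq i).1)
  refine ⟨c, hc, fun X X' hX hX' hXlim w' hw' => ?_⟩
  exact hS (fun i => q (i + N)) u (fun i => X (i + N)) _ X' (hqlim.comp hshift) hu hulim
    (fun i => hX _) hX' (hXlim.comp hshift) w' hw'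

/-- The velocities of the rays at the interior points outside of `S`. -/
def regularRays (φ : FinslerMetric n M) (Γ : (x : M) → TangentSpace (𝓡∂ n) x) (S : Set M) :
    Set (TM n M) :=
  {z | z ∈ rays φ Γ S ∧ z.proj ∈ (𝓡∂ n).interior M \ S}

theorem mem_R_iff {φ : FinslerMetric n M} {Γ : (x : M) → TangentSpace (𝓡∂ n) x} {S : Set M}
    {p : M} (hp : p ∈ S) {X : TangentSpace (𝓡∂ n) p} :
    X ∈ R φ Γ S p ↔ (⟨p, X⟩ : TM n M) ∈ closure (regularRays φ Γ S) := by
  have := firstCountableTopology_tangentBundle (n := n) (M := M)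
  rw [mem_closure_iff_seq_limit]
  constructor
  · rintro (h | ⟨_, z, hz, hlim⟩)
    · exact absurd hp h.1
    · exact ⟨z, hz, hlim⟩
  · rintro ⟨z, hz, hlim⟩
    exact Or.inr ⟨hp, z, hz, hlim⟩

/-- The sets `R p` are upper semicontinuous along `S`. -/
theorem mem_R_of_tendsto {φ : FinslerMetric n M} {Γ : (x : M) → TangentSpace (𝓡∂ n) x} {S : Set M}
    {p : M} (hp : p ∈ S) {q : ℕ → M} (hq : ∀ i, q i ∈ S)
    {X : (i : ℕ) → TangentSpace (𝓡∂ n) (q i)} {X' : TangentSpace (𝓡∂ n) p}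
    (hX : ∀ i, X i ∈ R φ Γ S (q i))
    (hlim : Tendsto (fun i => (⟨q i, X i⟩ : TM n M)) atTop (𝓝 (⟨p, X'⟩ : TM n M))) :
    X' ∈ R φ Γ S p := by
  rw [mem_R_iff hp]
  exact isClosed_closure.mem_of_tendsto hlim
    (Eventually.of_forall fun i => (mem_R_iff (hq i)).1 (hX i))

/-- Every one form is dual to the zero vector: `φ` is not differentiable at `0` in any direction. -/
theorem isDualForm_zero (φ : FinslerMetric n M) (p : M) (w : TangentSpace (𝓡∂ n) p →L[ℝ] ℝ) :
    IsDualForm φ p 0 w := by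
  have h0 : φ.toFun ⟨p, 0⟩ = 0 := by
    have := φ.homog' p 0 2 two_pos
    rw [smul_zero] at this
    linarith
  refine ⟨by simp [h0], fun W hW => ?_⟩
  have h1 : HasDerivWithinAt (fun t : ℝ => φ.toFun ⟨p, 0 + t • W⟩) (φ.toFun ⟨p, W⟩) (Ici 0) 0 := by
    have h2 : HasDerivWithinAt (fun t : ℝ => t * φ.toFun ⟨p, W⟩) (φ.toFun ⟨p, W⟩) (Ici 0) 0 := by
      simpa using ((hasDerivAt_id (0 : ℝ)).mul_const (φ.toFun ⟨p, W⟩)).hasDerivWithinAt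
    have h3 (t : ℝ) (ht : t ∈ Ici (0 : ℝ)) :
        φ.toFun ⟨p, 0 + t • W⟩ = t * φ.toFun ⟨p, W⟩ := by
      rw [zero_add]
      rcases eq_or_lt_of_le (show 0 ≤ t from ht) with rfl | ht
      · rw [zero_smul, h0, zero_mul]
      · exact φ.homog' p W t ht
    exact h2.congr h3 (h3 0 self_mem_Ici)
  have h2 : φ.toFun ⟨p, W⟩ = 0 :=
    (uniqueDiffOn_Ici (0 : ℝ) 0 self_mem_Ici).eq_deriv _ h1 hW.hasDerivWithinAt
  by_contra hne
  have hW0 : W ≠ 0 := by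
    rintro rfl
    exact hne (map_zero w)
  exact absurd h2 (φ.pos' p W hW0).ne'

/-- The dual form of a nonzero vector is its momentum. -/
theorem isDualForm_iff (φ : FinslerMetric n M) {p₀ p : M} (hp : p ∈ (𝓡∂ n).interior M)
    (hp' : p ∈ (chartAt (EuclideanHalfSpace n) p₀).source) {x : 𝔼} (hx : x ≠ 0)
    {w : TangentSpace (𝓡∂ n) p →L[ℝ] ℝ} :
    IsDualForm φ p (fibreCoordSymm p₀ p x) w ↔
      w = (momentum (lagrangian φ p₀) (extChartAt (𝓡∂ n) p₀ p, x)).comp (fibreCoord p₀ p) := by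
  have hL := isFinslerLagrangian φ p₀
  set L := lagrangian φ p₀ with hLdef
  set P := extChartAt (𝓡∂ n) p₀ p with hP
  have hPU : P ∈ chartInterior p₀ := extChartAt_mem_chartInterior hp hp'
  have hφ (v : TangentSpace (𝓡∂ n) p) : φ.toFun ⟨p, v⟩ = √(2 * L P (fibreCoord p₀ p v)) := by
    rw [φ.eq_sqrt_lagrangian p₀ (z := (⟨p, v⟩ : TM n M)) hp',
      bundleChart_apply (z := (⟨p, v⟩ : TM n M)) hp']
  have hpos := hL.pos P hPU x hx
  have hφx : φ.toFun ⟨p, fibreCoordSymm p₀ p x⟩ ^ 2 = 2 * L P x := by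
    rw [hφ, fibreCoord_symm hp', Real.sq_sqrt (by positivity)]
  have hder (W : TangentSpace (𝓡∂ n) p) :
      HasDerivAt (fun t : ℝ => φ.toFun ⟨p, fibreCoordSymm p₀ p x + t • W⟩)
        (2 * momentum L (P, x) (fibreCoord p₀ p W) / (2 * √(2 * L P x))) 0 := by
    simp_rw [hφ, map_add, map_smul, fibreCoord_symm hp']
    have h1 := hL.hasDerivAt_line (v := x) (w := fibreCoord p₀ p W) hPU (t := 0) (by simpa using hx)
    have h2 := (h1.const_mul 2).sqrt (by simp only [zero_smul, add_zero]; positivity)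
    simpa only [zero_smul, add_zero] using h2
  have hself := hL.momentum_apply_self hPU hx
  constructor
  · rintro ⟨h1, h2⟩
    rw [hφx] at h1
    ext W
    -- the component of `W` in the hyperplane tangent to the indicatrix
    set b := momentum L (P, x) (fibreCoord p₀ p W) / (2 * L P x) with hb
    have h3 := h2 (W - b • fibreCoordSymm p₀ p x) (by
      convert hder (W - b • fibreCoordSymm p₀ p x) using 1
      rw [map_sub, map_smul, fibreCoord_symm hp', map_sub, map_smul, hself, smul_eq_mul, hb,
        div_mul_cancel₀ _ (by positivity)]
      simp)
    rw [map_sub, map_smul, h1, smul_eq_mul, hb, div_mul_cancel₀ _ (by positivity)] at h3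
    exact sub_eq_zero.1 h3
  · rintro rfl
    refine ⟨?_, fun W hW => ?_⟩
    · rw [hφx, ← hself, ContinuousLinearMap.comp_apply, fibreCoord_symm hp']
    · have h1 := (hder W).unique hW
      have h2 : 0 < √(2 * L P x) := Real.sqrt_pos.2 (by positivity)
      rw [div_eq_zero_iff] at h1
      rcases h1 with h1 | h1
      · rw [ContinuousLinearMap.comp_apply]; linarith
      · linarith

/-- The zero vector is not in `R p`: its dual forms would be all one forms, and these have no
maximum on a nonzero vector. -/
theorem IsBalancedSplitLocus.zero_notMem_R [T2Space M] {φ : FinslerMetric n M}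
    {Γ : (x : M) → TangentSpace (𝓡∂ n) x} {S : Set M} (hS : IsBalancedSplitLocus φ Γ S)
    {p : M} (hp : p ∈ S) : (0 : TangentSpace (𝓡∂ n) p) ∉ R φ Γ S p := by
  intro h0
  have hint := hS.1.subset_interior hp
  have hsrc := mem_chart_source (EuclideanHalfSpace n) p
  set P := extChartAt (𝓡∂ n) p p with hP
  obtain ⟨z, hz, hzlim⟩ : ∃ z : ℕ → TM n M,
      (∀ i, z i ∈ rays φ Γ S ∧ (z i).proj ∈ (𝓡∂ n).interior M \ S) ∧
      Tendsto z atTop (𝓝 (⟨p, 0⟩ : TM n M)) := by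
    rcases h0 with h | h
    · exact absurd hp h.1
    · exact h.2
  have hproj : Tendsto (fun i => (z i).proj) atTop (𝓝 p) :=
    ((FiberBundle.continuous_proj 𝔼 (TangentSpace (𝓡∂ n) : M → Type _)).tendsto _).comp hzlim
  obtain ⟨N, hN⟩ := eventually_atTop.1 (hproj.eventually
    ((chartAt (EuclideanHalfSpace n) p).open_source.mem_nhds hsrc))
  set z' : ℕ → TM n M := fun i => z (i + N) with hz'
  have hz'lim : Tendsto z' atTop (𝓝 (⟨p, 0⟩ : TM n M)) := hzlim.comp (tendsto_add_atTop_nat N)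
  have hq (i) : (z' i).proj ∈ (chartAt (EuclideanHalfSpace n) p).source ∧ (z' i).proj ≠ p := by
    refine ⟨hN _ (by omega), fun h => (hz (i + N)).2.2 ?_⟩
    change (z' i).proj ∈ S
    rwa [h]
  have hlim : Tendsto (fun i => extChartAt (𝓡∂ n) p (z' i).proj) atTop (𝓝 P) := by
    have h1 := (tendsto_bundleChart (p₀ := p) hsrc hz'lim).fst_nhds
    rw [bundleChart_apply (z := (⟨p, 0⟩ : TM n M)) hsrc] at h1
    exact h1.congr fun i => by rw [bundleChart_apply (hq i).1]
  have hne (i) : P - extChartAt (𝓡∂ n) p (z' i).proj ≠ 0 := by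
    rw [sub_ne_zero]
    intro h
    exact (hq i).2 ((extChartAt (𝓡∂ n) p).injOn (by simpa using (hq i).1)
      (by simp) h.symm)
  obtain ⟨e, he, ψ, hψ, hdir⟩ := (isCompact_sphere (0 : 𝔼) 1).tendsto_subseq
    (x := fun i => ‖P - extChartAt (𝓡∂ n) p (z' i).proj‖⁻¹ •
      (P - extChartAt (𝓡∂ n) p (z' i).proj)) fun i => by
        rw [mem_sphere_zero_iff_norm, norm_smul, norm_inv, norm_norm,
          inv_mul_cancel₀ (norm_ne_zero_iff.2 (hne i))]
  have he0 : e ≠ 0 := Metric.ne_of_mem_sphere he one_ne_zero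
  obtain ⟨c, hc, hgreat⟩ := (hS.2 p hp).isGreatest (q := fun i => (z' (ψ i)).proj) hint hsrc he0
    (fun i => hq _) (hlim.comp hψ.tendsto_atTop) hdir
  have h1 := hgreat (fun i => (z' (ψ i)).2) 0
    (fun i => Or.inl ⟨(hz (ψ i + N)).2.2, (hz (ψ i + N)).1⟩) h0
    (hz'lim.comp hψ.tendsto_atTop) 0 (isDualForm_zero φ p 0)
  have h2 := h1.2 ⟨(innerSL ℝ e).comp (fibreCoord p p), ⟨0, h0, isDualForm_zero φ p _⟩, rfl⟩
  simp only [ContinuousLinearMap.comp_apply, fibreCoord_symm hsrc, map_smul, innerSL_apply_apply,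
    real_inner_self_eq_norm_sq, zero_apply, smul_eq_mul] at h2
  have h3 : 0 < ‖e‖ := norm_pos_iff.2 he0
  have : 0 < c * ‖e‖ ^ 2 := by positivity
  linarith

/-- The coordinates in the chart at `p₀` of the dual forms of the vectors in `R p`. -/
def dualCoords (φ : FinslerMetric n M) (Γ : (x : M) → TangentSpace (𝓡∂ n) x) (S : Set M)
    (p₀ p : M) : Set (𝔼 →L[ℝ] ℝ) :=
  (fun x => momentum (lagrangian φ p₀) (extChartAt (𝓡∂ n) p₀ p, x)) ''
    {x | fibreCoordSymm p₀ p x ∈ R φ Γ S p}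

/-- The forms in `Rdual` are the pull-backs of the forms in `dualCoords`, and neither pulling back
nor passing to the convex hull changes the dimension of the span of the differences. -/
theorem IsBalancedSplitLocus.finrank_vectorSpan_dualCoords [T2Space M] {φ : FinslerMetric n M}
    {Γ : (x : M) → TangentSpace (𝓡∂ n) x} {S : Set M} (hS : IsBalancedSplitLocus φ Γ S)
    {p₀ p : M} (hp : p ∈ S) (hp' : p ∈ (chartAt (EuclideanHalfSpace n) p₀).source) :
    Module.finrank ℝ (vectorSpan ℝ (convexHull ℝ (Rdual φ Γ S p))) =
      Module.finrank ℝ (vectorSpan ℝ (dualCoords φ Γ S p₀ p)) := by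
  let Ψ : (𝔼 →L[ℝ] ℝ) →ₗ[ℝ] (TangentSpace (𝓡∂ n) p →L[ℝ] ℝ) :=
    { toFun := fun w => w.comp (fibreCoord p₀ p)
      map_add' := fun _ _ => rfl
      map_smul' := fun _ _ => rfl }
  have hΨ : Function.Injective Ψ := by
    intro w w' h
    ext v
    have h1 := congrArg (fun f => f (fibreCoordSymm p₀ p v)) h
    change w (fibreCoord p₀ p (fibreCoordSymm p₀ p v)) =
      w' (fibreCoord p₀ p (fibreCoordSymm p₀ p v)) at h1
    rwa [fibreCoord_symm hp'] at h1
  have hne (x : 𝔼) (hx : fibreCoordSymm p₀ p x ∈ R φ Γ S p) : x ≠ 0 := by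
    rintro rfl
    rw [map_zero] at hx
    exact hS.zero_notMem_R hp hx
  have himage : Rdual φ Γ S p = Ψ.toAffineMap '' dualCoords φ Γ S p₀ p := by
    ext w
    constructor
    · rintro ⟨X, hX, hw⟩
      rw [← fibreCoordSymm_apply hp' X] at hX hw
      rw [isDualForm_iff φ (hS.1.subset_interior hp) hp' (hne _ hX)] at hw
      exact ⟨_, ⟨_, hX, rfl⟩, hw.symm⟩
    · rintro ⟨_, ⟨x, hx, rfl⟩, rfl⟩
      exact ⟨_, hx, (isDualForm_iff φ (hS.1.subset_interior hp) hp' (hne _ hx)).2 rfl⟩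
  rw [← direction_affineSpan, affineSpan_convexHull, direction_affineSpan, himage,
    ← AffineMap.map_vectorSpan]
  exact (LinearEquiv.finrank_eq (Submodule.equivMapOfInjective Ψ hΨ _)).symm

/-- The coordinates of the points `p` at which `co (R*_p)` has dimension `k` and contains the
differences of `k` pairs of dual forms of vectors of norm at most `j` that are linearly
independent in the quantitative sense with constant `1 / (j + 1)`. -/
def spreadStratum (φ : FinslerMetric n M) (Γ : (x : M) → TangentSpace (𝓡∂ n) x) (S : Set M)
    (p₀ : M) (k j : ℕ) : Set 𝔼 :=
  {P | ∃ p ∈ S, p ∈ (chartAt (EuclideanHalfSpace n) p₀).source ∧ extChartAt (𝓡∂ n) p₀ p = P ∧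
    Module.finrank ℝ (vectorSpan ℝ (dualCoords φ Γ S p₀ p)) = k ∧
    ∃ x : Fin k → 𝔼 × 𝔼, ‖x‖ ≤ j ∧
      (∀ a, fibreCoordSymm p₀ p (x a).1 ∈ R φ Γ S p ∧ fibreCoordSymm p₀ p (x a).2 ∈ R φ Γ S p) ∧
      IsSpread (1 / ((j : ℝ) + 1)) fun a => momentum (lagrangian φ p₀) (P, (x a).1) -
        momentum (lagrangian φ p₀) (P, (x a).2)}

theorem exists_mem_spreadStratum {φ : FinslerMetric n M}
    {Γ : (x : M) → TangentSpace (𝓡∂ n) x} {S : Set M} {p₀ p : M} {k : ℕ} (hp : p ∈ S)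
    (hp' : p ∈ (chartAt (EuclideanHalfSpace n) p₀).source)
    (hk : Module.finrank ℝ (vectorSpan ℝ (dualCoords φ Γ S p₀ p)) = k) :
    ∃ j, extChartAt (𝓡∂ n) p₀ p ∈ spreadStratum φ Γ S p₀ k j := by
  obtain ⟨w, hw, hli⟩ : ∃ w : Fin k → 𝔼 →L[ℝ] ℝ,
      (∀ a, w a ∈ dualCoords φ Γ S p₀ p -ᵥ dualCoords φ Γ S p₀ p) ∧ LinearIndependent ℝ w := by
    subst hk
    obtain ⟨w, h1, -, h2⟩ := Submodule.exists_fun_fin_finrank_span_eq ℝ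
      (dualCoords φ Γ S p₀ p -ᵥ dualCoords φ Γ S p₀ p)
    exact ⟨w, h1, h2⟩
  have h1 (a) : ∃ x : 𝔼 × 𝔼, (fibreCoordSymm p₀ p x.1 ∈ R φ Γ S p ∧
      fibreCoordSymm p₀ p x.2 ∈ R φ Γ S p) ∧
      momentum (lagrangian φ p₀) (extChartAt (𝓡∂ n) p₀ p, x.1) -
        momentum (lagrangian φ p₀) (extChartAt (𝓡∂ n) p₀ p, x.2) = w a := by
    obtain ⟨_, ⟨x, hx, rfl⟩, _, ⟨y, hy, rfl⟩, h⟩ := hw a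
    exact ⟨(x, y), ⟨hx, hy⟩, h⟩
  choose x hxR hxw using h1
  obtain ⟨c, hc, hcw⟩ := exists_isSpread hli
  obtain ⟨j₁, hj₁⟩ := exists_nat_ge ‖x‖
  obtain ⟨j₂, hj₂⟩ := exists_nat_one_div_lt hc
  refine ⟨max j₁ j₂, p, hp, hp', rfl, hk, x, hj₁.trans (by exact_mod_cast le_max_left _ _), hxR, ?_⟩
  simp_rw [hxw]
  intro a ha
  refine le_trans ?_ (hcw a ha)
  refine le_trans ?_ hj₂.le
  exact one_div_le_one_div_of_le (by positivity) (by gcongr; exact le_max_right _ _)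

/-- The tangent directions of a stratum are annihilated by the differences of the dual forms. -/
theorem IsBalancedSplitLocus.apply_eq_zero_of_tangent [T2Space M] {φ : FinslerMetric n M}
    {Γ : (x : M) → TangentSpace (𝓡∂ n) x} {S : Set M} (hS : IsBalancedSplitLocus φ Γ S)
    {p₀ p : M} {k j : ℕ} (hp : p ∈ S) (hp' : p ∈ (chartAt (EuclideanHalfSpace n) p₀).source)
    (hk : Module.finrank ℝ (vectorSpan ℝ (dualCoords φ Γ S p₀ p)) = k) {y : ℕ → 𝔼} {v : 𝔼}
    (hy : ∀ i, y i ∈ spreadStratum φ Γ S p₀ k j ∧ y i ≠ extChartAt (𝓡∂ n) p₀ p)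
    (hlim : Tendsto y atTop (𝓝 (extChartAt (𝓡∂ n) p₀ p)))
    (hdir : Tendsto (fun i => ‖y i - extChartAt (𝓡∂ n) p₀ p‖⁻¹ •
      (y i - extChartAt (𝓡∂ n) p₀ p)) atTop (𝓝 v)) {w : 𝔼 →L[ℝ] ℝ}
    (hw : w ∈ vectorSpan ℝ (dualCoords φ Γ S p₀ p)) : w v = 0 := by
  have hL := isFinslerLagrangian φ p₀
  set L := lagrangian φ p₀ with hLdef
  set P := extChartAt (𝓡∂ n) p₀ p with hP
  have hint := hS.1.subset_interior hp
  have hPU : P ∈ chartInterior p₀ := extChartAt_mem_chartInterior hint hp'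
  choose q hqS hqsrc hqy _hqk x hxj hxR hxspread using fun i => (hy i).1
  obtain ⟨x', -, ψ, hψ, hxlim⟩ := (isCompact_closedBall (0 : Fin k → 𝔼 × 𝔼) j).tendsto_subseq
    (x := x) fun i => by simpa using hxj i
  have hlim' : Tendsto (fun i => y (ψ i)) atTop (𝓝 P) := hlim.comp hψ.tendsto_atTop
  have hx'a (a) : Tendsto (fun i => x (ψ i) a) atTop (𝓝 (x' a)) := tendsto_pi_nhds.1 hxlim a
  have hTM {ξ : ℕ → 𝔼} {ξ' : 𝔼} (hξ : Tendsto ξ atTop (𝓝 ξ')) :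
      Tendsto (fun i => (⟨q (ψ i), fibreCoordSymm p₀ (q (ψ i)) (ξ i)⟩ : TM n M)) atTop
        (𝓝 (⟨p, fibreCoordSymm p₀ p ξ'⟩ : TM n M)) := by
    refine tendsto_of_tendsto_bundleChart hp' (fun i => hqsrc _) ?_
    rw [bundleChart_apply (z := (⟨p, _⟩ : TM n M)) hp', fibreCoord_symm hp']
    refine (hlim'.prodMk_nhds hξ).congr fun i => ?_
    rw [bundleChart_apply (z := (⟨q (ψ i), _⟩ : TM n M)) (hqsrc _), fibreCoord_symm (hqsrc _),
      hqy]
  have hR₁ (a) : fibreCoordSymm p₀ p (x' a).1 ∈ R φ Γ S p :=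
    mem_R_of_tendsto hp (fun i => hqS (ψ i)) (fun i => (hxR (ψ i) a).1) (hTM (hx'a a).fst_nhds)
  have hR₂ (a) : fibreCoordSymm p₀ p (x' a).2 ∈ R φ Γ S p :=
    mem_R_of_tendsto hp (fun i => hqS (ψ i)) (fun i => (hxR (ψ i) a).2) (hTM (hx'a a).snd_nhds)
  have hne {ξ : 𝔼} (hξ : fibreCoordSymm p₀ p ξ ∈ R φ Γ S p) : ξ ≠ 0 := by
    rintro rfl
    rw [map_zero] at hξ
    exact hS.zero_notMem_R hp hξ
  have hmom {ξ : ℕ → 𝔼} {ξ' : 𝔼} (hξ : Tendsto ξ atTop (𝓝 ξ')) (h0 : ξ' ≠ 0) :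
      Tendsto (fun i => momentum L (y (ψ i), ξ i)) atTop (𝓝 (momentum L (P, ξ'))) :=
    (hL.contDiffAt_momentum hPU h0).continuousAt.tendsto.comp (hlim'.prodMk_nhds hξ)
  set w' : Fin k → 𝔼 →L[ℝ] ℝ := fun a => momentum L (P, (x' a).1) - momentum L (P, (x' a).2)
  have hspread : IsSpread (1 / ((j : ℝ) + 1)) w' := by
    refine IsSpread.of_tendsto (fun i => hxspread (ψ i)) (tendsto_pi_nhds.2 fun a => ?_)
    exact (hmom (hx'a a).fst_nhds (hne (hR₁ a))).sub (hmom (hx'a a).snd_nhds (hne (hR₂ a)))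
  -- the limit forms are `k` independent elements of a space of dimension `k`
  have hspan : Submodule.span ℝ (range w') = vectorSpan ℝ (dualCoords φ Γ S p₀ p) := by
    refine Submodule.eq_of_le_of_finrank_eq ?_ ?_
    · rw [Submodule.span_le]
      rintro _ ⟨a, rfl⟩
      exact vsub_mem_vectorSpan ℝ ⟨_, hR₁ a, rfl⟩ ⟨_, hR₂ a, rfl⟩
    · rw [finrank_span_eq_card (hspread.linearIndependent (by positivity)), Fintype.card_fin, hk]
  have hyP (i) : y i - P ≠ 0 := sub_ne_zero.2 (hy i).2
  have hv : ‖v‖ = 1 := by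
    refine tendsto_nhds_unique hdir.norm (tendsto_const_nhds.congr fun i => ?_)
    rw [norm_smul, norm_inv, norm_norm, inv_mul_cancel₀ (norm_ne_zero_iff.2 (hyP i))]
  have hv0 : -v ≠ 0 := by
    rw [neg_ne_zero, ← norm_ne_zero_iff, hv]
    exact one_ne_zero
  obtain ⟨c, hc, hgreat⟩ := (hS.2 p hp).isGreatest (q := fun i => q (ψ i)) (p₀ := p₀) hint hp' hv0
    (fun i => ⟨hqsrc _, fun h => (hy (ψ i)).2 (by rw [← hqy, h])⟩)
    (by simpa only [hqy] using hlim') (by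
      simp only [hqy]
      refine (hdir.neg.comp hψ.tendsto_atTop).congr fun i => ?_
      change -(‖y (ψ i) - P‖⁻¹ • (y (ψ i) - P)) = ‖P - y (ψ i)‖⁻¹ • (P - y (ψ i))
      rw [norm_sub_rev, ← smul_neg, neg_sub])
  have hw' (a) : w' a v = 0 := by
    have h1 := hgreat _ _ (fun i => (hxR (ψ i) a).1) (hR₁ a) (hTM (hx'a a).fst_nhds) _
      ((isDualForm_iff φ hint hp' (hne (hR₁ a))).2 rfl)
    have h2 := hgreat _ _ (fun i => (hxR (ψ i) a).2) (hR₂ a) (hTM (hx'a a).snd_nhds) _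
      ((isDualForm_iff φ hint hp' (hne (hR₂ a))).2 rfl)
    have h3 := h1.unique h2
    rw [ContinuousLinearMap.comp_apply, ContinuousLinearMap.comp_apply, fibreCoord_symm hp',
      map_smul, map_smul, map_neg, map_neg] at h3
    have h4 := smul_right_injective ℝ hc.ne' h3
    change momentum L (P, (x' a).1) v - momentum L (P, (x' a).2) v = 0
    exact sub_eq_zero.2 (neg_injective h4)
  rw [← hspan] at hw
  refine Submodule.span_induction (p := fun w _ => w v = 0) ?_ rfl ?_ ?_ hw
  · rintro _ ⟨a, rfl⟩
    exact hw' a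
  · intro f g _ _ hf hg
    rw [add_apply, hf, hg, add_zero]
  · intro b f _ hf
    rw [smul_apply, hf, smul_zero]

end SplitLoci
end SplitLocus

end

theorem mainTheorem8 {n : ℕ} [NeZero n] {M : Type*} [TopologicalSpace M]
    [ChartedSpace (EuclideanHalfSpace n) M] [IsManifold (𝓡∂ n) ∞ M]
    [T2Space M] [SecondCountableTopology M]
    (hcompact : IsCompact ((𝓡∂ n).boundary M))
    (φ : SplitLocus.FinslerMetric n M)
    (Γ : (x : M) → TangentSpace (𝓡∂ n) x)
    (hΓ : ContMDiffOn (𝓡∂ n) (𝓡∂ n).tangent ∞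
      (fun x => (⟨x, Γ x⟩ : TangentBundle (𝓡∂ n) M)) ((𝓡∂ n).boundary M))
    (hin : ∀ x ∈ (𝓡∂ n).boundary M, SplitLocus.PointsInside Γ x)
    (S : Set M) (hS : SplitLocus.IsBalancedSplitLocus φ Γ S)
    (k : ℕ) (hk : k ≤ n) :
    SplitLocus.IsRectifiable (n := n) (n - k)
      {p ∈ S | Module.finrank ℝ
        (vectorSpan ℝ (convexHull ℝ (SplitLocus.Rdual φ Γ S p))) = k} := by
  intro p₀
  refine SplitLocus.IsRectifiableEuclidean.mono
    (B := ⋃ j, SplitLocus.spreadStratum φ Γ S p₀ k j) ?_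
    (SplitLocus.IsRectifiableEuclidean.iUnion fun j =>
      SplitLocus.isRectifiableEuclidean_of_tangent ?_)
  · rintro _ ⟨p, ⟨⟨hp, hpk⟩, hp'⟩, rfl⟩
    rw [hS.finrank_vectorSpan_dualCoords hp hp'] at hpk
    exact mem_iUnion.2 (SplitLocus.exists_mem_spreadStratum hp hp' hpk)
  · rintro _ ⟨p, hp, hp', rfl, hpk, -⟩
    -- the common kernel of the differences of the dual forms at `p`
    set W : Subspace ℝ (Module.Dual ℝ (EuclideanSpace ℝ (Fin n))) :=
      (vectorSpan ℝ (SplitLocus.dualCoords φ Γ S p₀ p)).map (ContinuousLinearMap.coeLM ℝ) with hW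
    refine ⟨W.dualCoannihilator, ?_, fun y v hy hlim hdir => ?_⟩
    · have h1 := Subspace.finrank_add_finrank_dualCoannihilator_eq W
      have h2 : Module.finrank ℝ W = k := by
        rw [← hpk]
        exact (LinearEquiv.finrank_eq (Submodule.equivMapOfInjective _
          ContinuousLinearMap.coe_injective _)).symm
      rw [finrank_euclideanSpace, Fintype.card_fin] at h1
      omega
    · rw [Submodule.mem_dualCoannihilator]
      rintro _ ⟨w, hw, rfl⟩
      exact hS.apply_eq_zero_of_tangent hp hp' hpk hy hlim hdir hw
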